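/- Let $(M,g)$ and $(N,h)$ be smooth Riemannian manifolds, let $\varphi:M\to N$ be a smooth map and let $V$ be a smooth vector field on $M$. Let $\nabla$ and $\nabla^N$ be the Levi-Civita connections of $g$ and $h$, with curvature tensor $R(X,Y)Z=\nabla_X\nabla_YZ-\nabla_Y\nabla_XZ-\nabla_{[X,Y]}Z$ (and $R^N$ likewise on $N$), and let $\nabla^\varphi$ be the connection on the pull-back bundle $\varphi^{-1}TN$ induced by $\nabla^N$. With $\{e_i\}$ a local orthonormal frame on $M$, put, for a smooth section $v$ of $\varphi^{-1}TN$, $$\operatorname{tr}(\nabla^\varphi)^2v=\sum_i\Big(\nabla^\varphi_{e_i}\nabla^\varphi_{e_i}v-\nabla^\varphi_{\nabla_{e_i}e_i}v\Big),\qquad \operatorname{Ric}^\varphi v=\sum_iR^N(v,d\varphi(e_i))\,d\varphi(e_i),$$ and let $\operatorname{tr}\nabla^2V=\sum_i(\nabla_{e_i}\nabla_{e_i}V-\nabla_{\nabla_{e_i}e_i}V)$ and $\operatorname{Ric}V=\sum_iR(V,e_i)e_i$ be the corresponding operators on $TM$. Let $\nabla d\varphi(X,Y)=\nabla^\varphi_X(d\varphi(Y))-d\varphi(\nabla_XY)$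 be the second fundamental form of $\varphi$ and $\tau(\varphi)=\operatorname{tr}\nabla d\varphi=\sum_i\nabla d\varphi(e_i,e_i)$ its tension field. Then, at every point of $M$, $$\big(\operatorname{tr}(\nabla^\varphi)^2+\operatorname{Ric}^\varphi\big)\big(d\varphi(V)\big)=d\varphi\big((\operatorname{tr}\nabla^2+\operatorname{Ric})(V)\big)+\nabla^\varphi_V\tau(\varphi)+2\sum_i\nabla d\varphi(e_i,\nabla_{e_i}V).$$ -/

import Mathlib

open Bundle Manifold ContDiff FiberBundle

noncomputable section

namespace RiemMap

/-! ### Coordinate connections -/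

section Connection

variable {E : Type*} [NormedAddCommGroup E] [NormedSpace ℝ E]
  {M : Type*} [TopologicalSpace M] [ChartedSpace E M]
  {F : Type*} [NormedAddCommGroup F] [NormedSpace ℝ F]

theorem mvfderiv_congr {f g : M → F} {x : M} (h : f =ᶠ[nhds x] g) :
    mvfderiv 𝓘(ℝ, E) f x = mvfderiv 𝓘(ℝ, E) g x := by
  ext v
  simp only [mvfderiv, h.mfderiv_eq]
  rfl

variable (V : M → Type*) [TopologicalSpace (TotalSpace F V)]
  [∀ x, AddCommGroup (V x)] [∀ x, Module ℝ (V x)] [∀ x, TopologicalSpace (V x)]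
  [∀ x, IsTopologicalAddGroup (V x)] [∀ x, ContinuousSMul ℝ (V x)]
  [FiberBundle F V] [VectorBundle ℝ F V]

/-- An auxiliary (non-canonical) connection on a vector bundle: at the point `x`, differentiate the
components of the section in the preferred local trivialization at `x`. -/
def trivConn : CovariantDerivative 𝓘(ℝ, E) F V where
  toFun σ x := ((trivializationAt F V x).symmL ℝ x) ∘L
    mvfderiv 𝓘(ℝ, E) (fun y ↦ (trivializationAt F V x ⟨y, σ y⟩).2) x
  isCovariantDerivativeOnUniv :=
    { add := by
        intro σ σ' x hσ hσ' _
        have h1 := (mdifferentiableAt_section _ _).1 hσ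
        have h2 := (mdifferentiableAt_section _ _).1 hσ'
        have h3 : (fun y ↦ (trivializationAt F V x ⟨y, (σ + σ') y⟩).2) =ᶠ[nhds x]
            (fun y ↦ (trivializationAt F V x ⟨y, σ y⟩).2) +
              (fun y ↦ (trivializationAt F V x ⟨y, σ' y⟩).2) := by
          filter_upwards [(trivializationAt F V x).open_baseSet.mem_nhds
            (mem_baseSet_trivializationAt F V x)] with y hy
          exact ((trivializationAt F V x).linear ℝ hy).map_add _ _
        rw [mvfderiv_congr h3, mvfderiv_add h1 h2, ContinuousLinearMap.comp_add]
      leibniz := by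
        intro σ g x hσ hg _
        have h1 := (mdifferentiableAt_section _ _).1 hσ
        have h3 : (fun y ↦ (trivializationAt F V x ⟨y, (g • σ) y⟩).2) =ᶠ[nhds x]
            g • (fun y ↦ (trivializationAt F V x ⟨y, σ y⟩).2) := by
          filter_upwards [(trivializationAt F V x).open_baseSet.mem_nhds
            (mem_baseSet_trivializationAt F V x)] with y hy
          exact ((trivializationAt F V x).linear ℝ hy).map_smul _ _
        rw [mvfderiv_congr h3, mvfderiv_smul hg h1]
        ext v
        simp [mem_baseSet_trivializationAt F V x] }

end Connection

/-! ### The Levi-Civita connection -/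

section LeviCivita

variable {E : Type*} [NormedAddCommGroup E] [NormedSpace ℝ E]
  {M : Type*} [TopologicalSpace M] [ChartedSpace E M] [IsManifold 𝓘(ℝ, E) ∞ M]
  (g : ContMDiffRiemannianMetric 𝓘(ℝ, E) ∞ E (fun x : M ↦ TangentSpace 𝓘(ℝ, E) x))

theorem mdifferentiableAt_metric {σ τ : Π x : M, TangentSpace 𝓘(ℝ, E) x} {x : M}
    (hσ : MDiffAt (T% σ) x) (hτ : MDiffAt (T% τ) x) :
    MDiffAt (fun y ↦ g.inner y (σ y) (τ y)) x := by
  have : MDifferentiableAt 𝓘(ℝ, E) (𝓘(ℝ, E).prod 𝓘(ℝ))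
      (fun m ↦ TotalSpace.mk' ℝ (E := Bundle.Trivial M ℝ) m (g.inner m (σ m) (τ m))) x := by
    apply MDifferentiableAt.clm_bundle_apply₂ (F₁ := E) (F₂ := E)
    · exact g.contMDiff.mdifferentiableAt (by simp)
    · exact hσ
    · exact hτ
  simp only [mdifferentiableAt_totalSpace] at this
  exact this.2

theorem extend_add_vec {x : M} (v w : TangentSpace 𝓘(ℝ, E) x) :
    ∀ᶠ y in nhds x, extend E (v + w) y = extend E v y + extend E w y := by
  filter_upwards [(trivializationAt E (TangentSpace 𝓘(ℝ, E)) x).open_baseSet.mem_nhds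
    (mem_baseSet_trivializationAt E (TangentSpace 𝓘(ℝ, E)) x)] with y hy
  simp only [extend]
  rw [((trivializationAt E (TangentSpace 𝓘(ℝ, E)) x).linear ℝ
    (mem_baseSet_trivializationAt E (TangentSpace 𝓘(ℝ, E)) x)).map_add]
  simp only [← Trivialization.symmₗ_apply (R := ℝ) _ hy, map_add]

theorem extend_smul_vec {x : M} (c : ℝ) (v : TangentSpace 𝓘(ℝ, E) x) :
    ∀ᶠ y in nhds x, extend E (c • v) y = c • extend E v y := by
  filter_upwards [(trivializationAt E (TangentSpace 𝓘(ℝ, E)) x).open_baseSet.mem_nhds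
    (mem_baseSet_trivializationAt E (TangentSpace 𝓘(ℝ, E)) x)] with y hy
  simp only [extend]
  rw [((trivializationAt E (TangentSpace 𝓘(ℝ, E)) x).linear ℝ
    (mem_baseSet_trivializationAt E (TangentSpace 𝓘(ℝ, E)) x)).map_smul]
  simp only [← Trivialization.symmₗ_apply (R := ℝ) _ hy, map_smul]

/-- The coordinate derivative `(∂_a g)(b, c)` at `x`, where `b` and `c` are extended with constant
components in the preferred chart at `x`. -/
def metricDeriv (x : M) (a b c : TangentSpace 𝓘(ℝ, E) x) : ℝ :=
  mvfderiv 𝓘(ℝ, E) (fun y ↦ g.inner y (extend E b y) (extend E c y)) x a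

theorem metricDeriv_symm (x : M) (a b c : TangentSpace 𝓘(ℝ, E) x) :
    metricDeriv g x a b c = metricDeriv g x a c b := by
  unfold metricDeriv
  simp only [g.symm]

theorem metricDeriv_add_left (x : M) (a a' b c : TangentSpace 𝓘(ℝ, E) x) :
    metricDeriv g x (a + a') b c = metricDeriv g x a b c + metricDeriv g x a' b c := by
  simp [metricDeriv]

theorem metricDeriv_smul_left (x : M) (r : ℝ) (a b c : TangentSpace 𝓘(ℝ, E) x) :
    metricDeriv g x (r • a) b c = r * metricDeriv g x a b c := by
  simp [metricDeriv]

theorem metricDeriv_add_mid (x : M) (a b b' c : TangentSpace 𝓘(ℝ, E) x) :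
    metricDeriv g x a (b + b') c = metricDeriv g x a b c + metricDeriv g x a b' c := by
  have h := mvfderiv_add
    (mdifferentiableAt_metric g (mdifferentiableAt_extend 𝓘(ℝ, E) E b)
      (mdifferentiableAt_extend 𝓘(ℝ, E) E c))
    (mdifferentiableAt_metric g (mdifferentiableAt_extend 𝓘(ℝ, E) E b')
      (mdifferentiableAt_extend 𝓘(ℝ, E) E c))
  have h' := congrArg (fun L ↦ L a) h
  refine Eq.trans ?_ h'
  refine congrArg (fun L : TangentSpace 𝓘(ℝ, E) x →L[ℝ] ℝ ↦ L a)
      (mvfderiv_congr (E := E) (F := ℝ) (x := x) ?_)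
  filter_upwards [extend_add_vec b b'] with y hy
  simp [hy]

theorem metricDeriv_smul_mid (x : M) (r : ℝ) (a b c : TangentSpace 𝓘(ℝ, E) x) :
    metricDeriv g x a (r • b) c = r * metricDeriv g x a b c := by
  have h := mvfderiv_smul (a := fun _ : M ↦ r) mdifferentiableAt_const
    (mdifferentiableAt_metric g (mdifferentiableAt_extend 𝓘(ℝ, E) E b)
      (mdifferentiableAt_extend 𝓘(ℝ, E) E c))
  have h' := congrArg (fun L ↦ L a) h
  simp only [mvfderiv_const] at h'
  refine Eq.trans ?_ (h'.trans ?_)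
  · refine congrArg (fun L : TangentSpace 𝓘(ℝ, E) x →L[ℝ] ℝ ↦ L a)
      (mvfderiv_congr (E := E) (F := ℝ) (x := x) ?_)
    filter_upwards [extend_smul_vec r b] with y hy
    simp [hy]
  · simp [metricDeriv]

theorem metricDeriv_add_right (x : M) (a b c c' : TangentSpace 𝓘(ℝ, E) x) :
    metricDeriv g x a b (c + c') = metricDeriv g x a b c + metricDeriv g x a b c' := by
  rw [metricDeriv_symm, metricDeriv_add_mid, metricDeriv_symm g x a c, metricDeriv_symm g x a c']

theorem metricDeriv_smul_right (x : M) (r : ℝ) (a b c : TangentSpace 𝓘(ℝ, E) x) :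
    metricDeriv g x a b (r • c) = r * metricDeriv g x a b c := by
  rw [metricDeriv_symm, metricDeriv_smul_mid, metricDeriv_symm g x a c]

theorem trivConn_extend (x : M) (b : TangentSpace 𝓘(ℝ, E) x) :
    trivConn (E := E) (F := E) (fun x : M ↦ TangentSpace 𝓘(ℝ, E) x) (extend E b) x = 0 := by
  have h3 : (fun y ↦ (trivializationAt E (TangentSpace 𝓘(ℝ, E)) x ⟨y, extend E b y⟩).2) =ᶠ[nhds x]
      fun _ ↦ (trivializationAt E (TangentSpace 𝓘(ℝ, E)) x ⟨x, b⟩).2 := by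
    filter_upwards [(trivializationAt E (TangentSpace 𝓘(ℝ, E)) x).open_baseSet.mem_nhds
      (mem_baseSet_trivializationAt E (TangentSpace 𝓘(ℝ, E)) x)] with y hy
    change (trivializationAt E (TangentSpace 𝓘(ℝ, E)) x ⟨y,
      (trivializationAt E (TangentSpace 𝓘(ℝ, E)) x).symm y _⟩).2 = _
    rw [Trivialization.apply_mk_symm _ hy]
  change _ ∘L mvfderiv 𝓘(ℝ, E) _ x = 0
  rw [mvfderiv_congr h3, mvfderiv_const, ContinuousLinearMap.comp_zero]

theorem lieBracketWithin_of_const {P Q : E → E} {p q z : E} (hP : P =ᶠ[nhds z] fun _ ↦ p)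
    (hQ : Q =ᶠ[nhds z] fun _ ↦ q) : VectorField.lieBracketWithin ℝ P Q Set.univ z = 0 := by
  rw [VectorField.lieBracketWithin_univ, VectorField.lieBracket_eq]
  simp [hP.fderiv_eq, hQ.fderiv_eq]

variable [FiniteDimensional ℝ E]

instance tangentSpace_finiteDimensional (x : M) : FiniteDimensional ℝ (TangentSpace 𝓘(ℝ, E) x) :=
  inferInstanceAs (FiniteDimensional ℝ E)

instance tangentSpace_t2Space (x : M) : T2Space (TangentSpace 𝓘(ℝ, E) x) :=
  inferInstanceAs (T2Space E)

theorem exists_orthonormal_basis (x : M) :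
    ∃ e : Module.Basis (Fin (Module.finrank ℝ E)) ℝ (TangentSpace 𝓘(ℝ, E) x),
      ∀ i j, g.inner x (e i) (e j) = if i = j then 1 else 0 := by
  let c := g.toRiemannianMetric.toCore x
  let : NormedAddCommGroup (TangentSpace 𝓘(ℝ, E) x) := c.toNormedAddCommGroup
  let : InnerProductSpace ℝ (TangentSpace 𝓘(ℝ, E) x) := InnerProductSpace.ofCore c.toCore
  refine ⟨(stdOrthonormalBasis ℝ (TangentSpace 𝓘(ℝ, E) x)).toBasis, fun i j ↦ ?_⟩
  have := orthonormal_iff_ite.1 (stdOrthonormalBasis ℝ (TangentSpace 𝓘(ℝ, E) x)).orthonormal i j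
  rwa [← OrthonormalBasis.coe_toBasis] at this

/-- A basis of the tangent space at `x` that is orthonormal for the metric `g`. -/
def onb (x : M) : Module.Basis (Fin (Module.finrank ℝ E)) ℝ (TangentSpace 𝓘(ℝ, E) x) :=
  (exists_orthonormal_basis g x).choose

theorem onb_orthonormal (x : M) (i j : Fin (Module.finrank ℝ E)) :
    g.inner x (onb g x i) (onb g x j) = if i = j then 1 else 0 :=
  (exists_orthonormal_basis g x).choose_spec i j

/-- The Christoffel symbols at `x`, in the preferred chart at `x`: `Γ(b, a)` is the vector with
`g(Γ(b, a), c) = ((∂_a g)(b, c) + (∂_b g)(a, c) - (∂_c g)(a, b)) / 2` for all `c`. -/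
def christoffel (x : M) : TangentSpace 𝓘(ℝ, E) x →L[ℝ] TangentSpace 𝓘(ℝ, E) x →L[ℝ]
    TangentSpace 𝓘(ℝ, E) x :=
  LinearMap.toContinuousBilinearMap (LinearMap.mk₂ ℝ
    (fun b a ↦ ∑ i, ((1 / 2 : ℝ) * (metricDeriv g x a b (onb g x i)
      + metricDeriv g x b a (onb g x i) - metricDeriv g x (onb g x i) a b)) • onb g x i)
    (fun b b' a ↦ by
      rw [← Finset.sum_add_distrib]
      refine Finset.sum_congr rfl fun i _ ↦ ?_
      rw [metricDeriv_add_mid, metricDeriv_add_left, metricDeriv_add_right, ← add_smul]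
      congr 1
      ring)
    (fun r b a ↦ by
      rw [Finset.smul_sum]
      refine Finset.sum_congr rfl fun i _ ↦ ?_
      rw [metricDeriv_smul_mid, metricDeriv_smul_left, metricDeriv_smul_right, smul_smul]
      congr 1
      ring)
    (fun b a a' ↦ by
      rw [← Finset.sum_add_distrib]
      refine Finset.sum_congr rfl fun i _ ↦ ?_
      rw [metricDeriv_add_left, metricDeriv_add_mid, metricDeriv_add_mid, ← add_smul]
      congr 1
      ring)
    (fun r b a ↦ by
      rw [Finset.smul_sum]
      refine Finset.sum_congr rfl fun i _ ↦ ?_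
      rw [metricDeriv_smul_left, metricDeriv_smul_mid, metricDeriv_smul_mid, smul_smul]
      congr 1
      ring))

/-- The Levi-Civita connection of `g`: `(∇_a Y)(x) = ∂_a Y + Γ(Y(x), a)` in the preferred chart
at `x`. -/
def leviCivita : CovariantDerivative 𝓘(ℝ, E) E (fun x : M ↦ TangentSpace 𝓘(ℝ, E) x) :=
  (trivConn (fun x : M ↦ TangentSpace 𝓘(ℝ, E) x)).addOneForm (christoffel g)

theorem christoffel_apply (x : M) (b a : TangentSpace 𝓘(ℝ, E) x) :
    christoffel g x b a = ∑ i, ((1 / 2 : ℝ) * (metricDeriv g x a b (onb g x i)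
      + metricDeriv g x b a (onb g x i) - metricDeriv g x (onb g x i) a b)) • onb g x i := rfl

theorem inner_christoffel (x : M) (b a c : TangentSpace 𝓘(ℝ, E) x) :
    g.inner x (christoffel g x b a) c = (1 / 2 : ℝ) * (metricDeriv g x a b c
      + metricDeriv g x b a c - metricDeriv g x c a b) := by
  let R : TangentSpace 𝓘(ℝ, E) x →ₗ[ℝ] ℝ :=
    { toFun := fun c ↦ (1 / 2 : ℝ) * (metricDeriv g x a b c
        + metricDeriv g x b a c - metricDeriv g x c a b)
      map_add' := fun c c' ↦ by
        rw [metricDeriv_add_right, metricDeriv_add_right, metricDeriv_add_left]; ring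
      map_smul' := fun r c ↦ by
        rw [metricDeriv_smul_right, metricDeriv_smul_right, metricDeriv_smul_left]
        simp only [RingHom.id_apply, smul_eq_mul]; ring }
  have h : (g.inner x (christoffel g x b a)).toLinearMap = R := by
    refine (onb g x).ext fun j ↦ ?_
    simp [christoffel_apply, onb_orthonormal, R]
  exact congrArg (fun L ↦ L c) h

/-- The Levi-Civita connection is compatible with the metric. -/
theorem leviCivita_metric {σ τ : Π x : M, TangentSpace 𝓘(ℝ, E) x} {x : M}
    (hσ : MDiffAt (T% σ) x) (hτ : MDiffAt (T% τ) x) (a : TangentSpace 𝓘(ℝ, E) x) :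
    mvfderiv 𝓘(ℝ, E) (fun y ↦ g.inner y (σ y) (τ y)) x a =
      g.inner x (leviCivita g σ x a) (τ x) + g.inner x (σ x) (leviCivita g τ x a) := by
  let D := trivConn (E := E) (F := E) (fun x : M ↦ TangentSpace 𝓘(ℝ, E) x)
  let Φ (σ τ : Π x : M, TangentSpace 𝓘(ℝ, E) x) : ℝ :=
    mvfderiv 𝓘(ℝ, E) (fun y ↦ g.inner y (σ y) (τ y)) x a
      - g.inner x (D σ x a) (τ x) - g.inner x (σ x) (D τ x a)
  have hsymm (σ τ) : Φ σ τ = Φ τ σ := by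
    simp only [Φ, g.symm _ (D σ x a), g.symm _ (σ x) (D τ x a), g.symm _ (σ _) (τ _)]
    ring
  have h1 (τ : Π x : M, TangentSpace 𝓘(ℝ, E) x) (hτ : MDiffAt (T% τ) x) :
      TensorialAt 𝓘(ℝ, E) E (Φ · τ) x :=
    { smul := fun {f σ} hf hσ ↦ by
        have e1 : (fun y ↦ g.inner y ((f • σ) y) (τ y)) =
            f • (fun y ↦ g.inner y (σ y) (τ y)) := by
          funext y; simp
        have e2 := D.isCovariantDerivativeOnUniv.leibniz hσ hf
        simp only [Φ]
        rw [e1, mvfderiv_smul hf (mdifferentiableAt_metric g hσ hτ), e2]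
        simp
        ring
      add := fun {σ σ'} hσ hσ' ↦ by
        have e1 : (fun y ↦ g.inner y ((σ + σ') y) (τ y)) =
            (fun y ↦ g.inner y (σ y) (τ y)) + (fun y ↦ g.inner y (σ' y) (τ y)) := by
          funext y; simp
        have e2 := D.isCovariantDerivativeOnUniv.add hσ hσ'
        simp only [Φ]
        rw [e1, mvfderiv_add (mdifferentiableAt_metric g hσ hτ) (mdifferentiableAt_metric g hσ' hτ),
          e2]
        simp
        ring }
  have h2 (σ : Π x : M, TangentSpace 𝓘(ℝ, E) x) (hσ : MDiffAt (T% σ) x) :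
      TensorialAt 𝓘(ℝ, E) E (Φ σ ·) x := by
    simpa only [hsymm σ] using h1 σ hσ
  have key : Φ σ τ = metricDeriv g x a (σ x) (τ x) := by
    rw [TensorialAt.pointwise₂ h1 h2 hσ (mdifferentiableAt_extend 𝓘(ℝ, E) E (σ x)) hτ
      (mdifferentiableAt_extend 𝓘(ℝ, E) E (τ x)) (by simp) (by simp)]
    simp [Φ, D, trivConn_extend, metricDeriv]
  have e (σ : Π x : M, TangentSpace 𝓘(ℝ, E) x) :
      leviCivita g σ x a = D σ x a + christoffel g x (σ x) a := rfl
  rw [e, e, map_add, map_add, add_apply, inner_christoffel,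
    g.symm x (σ x) (christoffel g x (τ x) a), inner_christoffel]
  have s1 := metricDeriv_symm g x a (σ x) (τ x)
  have s2 := metricDeriv_symm g x (σ x) a (τ x)
  have s3 := metricDeriv_symm g x (τ x) a (σ x)
  simp only [Φ] at key
  linarith

theorem mlieBracket_extend (x : M) (b c : TangentSpace 𝓘(ℝ, E) x) :
    VectorField.mlieBracket 𝓘(ℝ, E) (extend E b) (extend E c) x = 0 := by
  have hc (b : TangentSpace 𝓘(ℝ, E) x) :
      VectorField.mpullbackWithin 𝓘(ℝ, E) 𝓘(ℝ, E) (extChartAt 𝓘(ℝ, E) x).symm (extend E b)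
        (Set.range 𝓘(ℝ, E)) =ᶠ[nhds (extChartAt 𝓘(ℝ, E) x x)]
        fun _ ↦ (trivializationAt E (TangentSpace 𝓘(ℝ, E)) x ⟨x, b⟩).2 := by
    filter_upwards [extChartAt_target_mem_nhds (I := 𝓘(ℝ, E)) x] with u hu
    have hy : (extChartAt 𝓘(ℝ, E) x).symm u ∈ (chartAt E x).source := by
      simpa using (extChartAt 𝓘(ℝ, E) x).map_target hu
    have h := TangentBundle.symmL_trivializationAt (I := 𝓘(ℝ, E)) hy
    rw [(extChartAt 𝓘(ℝ, E) x).right_inv hu] at h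
    have hb : (extChartAt 𝓘(ℝ, E) x).symm u ∈
        (trivializationAt E (TangentSpace 𝓘(ℝ, E)) x).baseSet := hy
    have h2 : extend E b ((extChartAt 𝓘(ℝ, E) x).symm u) =
        (mfderivWithin 𝓘(ℝ, E) 𝓘(ℝ, E) (extChartAt 𝓘(ℝ, E) x).symm (Set.range 𝓘(ℝ, E)) u)
          (trivializationAt E (TangentSpace 𝓘(ℝ, E)) x ⟨x, b⟩).2 := by
      rw [← h]
      exact (Trivialization.symmL_apply (R := ℝ) _ hb _).symm
    rw [VectorField.mpullbackWithin_apply, h2]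
    exact (isInvertible_mfderivWithin_extChartAt_symm hu).inverse_apply_self _
  rw [← VectorField.mlieBracketWithin_univ, VectorField.mlieBracketWithin_apply]
  have h0 : VectorField.lieBracketWithin ℝ
      (VectorField.mpullbackWithin 𝓘(ℝ, E) 𝓘(ℝ, E) (extChartAt 𝓘(ℝ, E) x).symm (extend E b)
        (Set.range 𝓘(ℝ, E)))
      (VectorField.mpullbackWithin 𝓘(ℝ, E) 𝓘(ℝ, E) (extChartAt 𝓘(ℝ, E) x).symm (extend E c)
        (Set.range 𝓘(ℝ, E)))
      ((extChartAt 𝓘(ℝ, E) x).symm ⁻¹' Set.univ ∩ Set.range 𝓘(ℝ, E))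
      (extChartAt 𝓘(ℝ, E) x x) = 0 := by
    rw [show (extChartAt 𝓘(ℝ, E) x).symm ⁻¹' Set.univ ∩ Set.range 𝓘(ℝ, E) = Set.univ by simp]
    exact lieBracketWithin_of_const (hc b) (hc c)
  rw [h0]
  exact map_zero (mfderiv 𝓘(ℝ, E) 𝓘(ℝ, E) (extChartAt 𝓘(ℝ, E) x) x).inverse

/-- The Levi-Civita connection is torsion-free. -/
theorem leviCivita_torsion : (leviCivita g).torsion = 0 := by
  funext x
  ext b c
  rw [CovariantDerivative.torsion_apply_eq_extend, mlieBracket_extend]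
  have e (σ : Π x : M, TangentSpace 𝓘(ℝ, E) x) (a : TangentSpace 𝓘(ℝ, E) x) :
      leviCivita g σ x a = trivConn (E := E) (F := E) (fun x : M ↦ TangentSpace 𝓘(ℝ, E) x) σ x a
        + christoffel g x (σ x) a := rfl
  have s : christoffel g x b c = christoffel g x c b := by
    simp only [christoffel_apply]
    refine Finset.sum_congr rfl fun i _ ↦ ?_
    rw [metricDeriv_symm g x (onb g x i), add_comm (metricDeriv g x c b _)]
  rw [e, e, trivConn_extend, trivConn_extend]
  simp [s]

end LeviCivita

/-! ### Operators along a smooth map -/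

section Pullback

variable {M N : Type*} {T : N → Type*} (f : M → N)

instance pullback_addCommGroup [∀ y, AddCommGroup (T y)] (x : M) :
    AddCommGroup ((f *ᵖ T) x) :=
  inferInstanceAs (AddCommGroup (T (f x)))

instance pullback_isTopologicalAddGroup [∀ y, AddCommGroup (T y)] [∀ y, TopologicalSpace (T y)]
    [∀ y, IsTopologicalAddGroup (T y)] (x : M) : IsTopologicalAddGroup ((f *ᵖ T) x) :=
  inferInstanceAs (IsTopologicalAddGroup (T (f x)))

instance pullback_continuousSMul [∀ y, AddCommGroup (T y)] [∀ y, Module ℝ (T y)]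
    [∀ y, TopologicalSpace (T y)] [∀ y, ContinuousSMul ℝ (T y)] (x : M) :
    ContinuousSMul ℝ ((f *ᵖ T) x) :=
  inferInstanceAs (ContinuousSMul ℝ (T (f x)))

end Pullback

section Maps

variable {E : Type*} [NormedAddCommGroup E] [NormedSpace ℝ E] [FiniteDimensional ℝ E]
  {M : Type*} [TopologicalSpace M] [ChartedSpace E M] [IsManifold 𝓘(ℝ, E) ∞ M]
  (g : ContMDiffRiemannianMetric 𝓘(ℝ, E) ∞ E (fun x : M ↦ TangentSpace 𝓘(ℝ, E) x))
  {F : Type*} [NormedAddCommGroup F] [NormedSpace ℝ F] [FiniteDimensional ℝ F]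
  {N : Type*} [TopologicalSpace N] [ChartedSpace F N] [IsManifold 𝓘(ℝ, F) ∞ N]
  (h : ContMDiffRiemannianMetric 𝓘(ℝ, F) ∞ F (fun y : N ↦ TangentSpace 𝓘(ℝ, F) y))
  (φ : C^∞⟮𝓘(ℝ, E), M; 𝓘(ℝ, F), N⟯)

/-- The pull-back bundle `φ⁻¹TN`, with fiber `T_{φ(x)}N` at `x`. -/
abbrev PullbackTangent (x : M) : Type _ := ((φ : M → N) *ᵖ (fun y : N ↦ TangentSpace 𝓘(ℝ, F) y)) x

/-- The differential of `φ` at `x`, with values in the fiber of `φ⁻¹TN`. -/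
def differential (x : M) : TangentSpace 𝓘(ℝ, E) x →L[ℝ] PullbackTangent φ x :=
  mfderiv 𝓘(ℝ, E) 𝓘(ℝ, F) φ x

/-- The Christoffel term of `h` along `φ`: `(b, a) ↦ Γ(b, dφ(a))`. -/
def christoffelAlong (x : M) :
    PullbackTangent φ x →L[ℝ] TangentSpace 𝓘(ℝ, E) x →L[ℝ] PullbackTangent φ x :=
  letI Γ : TangentSpace 𝓘(ℝ, F) (φ x) →L[ℝ] TangentSpace 𝓘(ℝ, E) x →L[ℝ]
      TangentSpace 𝓘(ℝ, F) (φ x) :=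
    LinearMap.toContinuousBilinearMap (LinearMap.mk₂ ℝ
      (fun b a ↦ christoffel h (φ x) b (mfderiv 𝓘(ℝ, E) 𝓘(ℝ, F) φ x a))
      (by simp) (by simp) (by simp) (by simp))
  Γ

/-- The connection `∇^φ` on the pull-back bundle `φ⁻¹TN` induced by the Levi-Civita connection
of `h`. -/
def pullbackConn : CovariantDerivative 𝓘(ℝ, E) F (PullbackTangent φ) :=
  (trivConn (PullbackTangent φ)).addOneForm
    (christoffelAlong h φ)

/-- The defining property of the pull-back connection: `∇^φ_a (W ∘ φ) = ∇^N_{dφ(a)} W`. -/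
theorem pullbackConn_comp (W : Π y : N, TangentSpace 𝓘(ℝ, F) y) (x : M) (hW : MDiffAt (T% W) (φ x))
    (a : TangentSpace 𝓘(ℝ, E) x) :
    pullbackConn h φ (fun z ↦ W (φ z)) x a =
      leviCivita h W (φ x) (mfderiv 𝓘(ℝ, E) 𝓘(ℝ, F) φ x a) := by
  have hW' := (mdifferentiableAt_section _ _).1 hW
  have h1 : mvfderiv 𝓘(ℝ, E) (fun z ↦ (trivializationAt F (PullbackTangent φ) x ⟨z, W (φ z)⟩).2) x a =
      mvfderiv 𝓘(ℝ, F) (fun y ↦ (trivializationAt F (TangentSpace 𝓘(ℝ, F)) (φ x) ⟨y, W y⟩).2)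
        (φ x) (mfderiv 𝓘(ℝ, E) 𝓘(ℝ, F) φ x a) :=
    mfderiv_comp_apply (I' := 𝓘(ℝ, F)) x hW' (φ.contMDiff.mdifferentiableAt (by simp)) a
  have h2 (b : F) : (trivializationAt F (PullbackTangent φ) x).symmL ℝ x b =
      (trivializationAt F (TangentSpace 𝓘(ℝ, F)) (φ x)).symmL ℝ (φ x) b := by
    have hx := mem_baseSet_trivializationAt F (PullbackTangent φ) x
    have hy := mem_baseSet_trivializationAt F (TangentSpace 𝓘(ℝ, F)) (φ x)
    rw [Trivialization.symmL_apply _ hx, Trivialization.symmL_apply _ hy]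
    have h3 : (trivializationAt F (TangentSpace 𝓘(ℝ, F)) (φ x)
        ⟨φ x, (trivializationAt F (PullbackTangent φ) x).symm x b⟩).2 = b :=
      congrArg Prod.snd (Trivialization.apply_mk_symm (trivializationAt F (PullbackTangent φ) x)
        hx b)
    have h4 := Trivialization.symm_apply_apply_mk (trivializationAt F (TangentSpace 𝓘(ℝ, F)) (φ x))
      hy ((trivializationAt F (PullbackTangent φ) x).symm x b)
    rw [h3] at h4
    exact h4.symm
  change (trivializationAt F (PullbackTangent φ) x).symmL ℝ x
      (mvfderiv 𝓘(ℝ, E) (fun z ↦ (trivializationAt F (PullbackTangent φ) x ⟨z, W (φ z)⟩).2) x a) +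
      christoffelAlong h φ x (W (φ x)) a = _
  rw [h1, h2]
  rfl

/-- The differential of `φ` applied to a vector field, a section of `φ⁻¹TN`. -/
def push (X : Π x : M, TangentSpace 𝓘(ℝ, E) x) :
    Π x : M, PullbackTangent φ x :=
  fun x ↦ differential φ x (X x)

/-- The second fundamental form `∇dφ(a, b) = ∇^φ_a (dφ(B)) - dφ(∇_a B)` at `x`, where `B` is a
local vector field with `B(x) = b` (the value does not depend on the choice of `B`). -/
def secondFundamentalForm (x : M) (a b : TangentSpace 𝓘(ℝ, E) x) :
    PullbackTangent φ x :=
  letI B := extend E b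
  pullbackConn h φ (push φ B) x a
    - differential φ x (leviCivita g B x a)

/-- The tension field `τ(φ) = tr ∇dφ`. -/
def tension : Π x : M, PullbackTangent φ x :=
  fun x ↦ ∑ i, secondFundamentalForm g h φ x (onb g x i) (onb g x i)

/-- The curvature tensor `R(a, b)c = ∇_A ∇_B C - ∇_B ∇_A C - ∇_[A,B] C` at `x`, where `A`, `B`, `C`
are local vector fields with values `a`, `b`, `c` at `x` (the value does not depend on the choice
of these fields). -/
def curvature (x : M) (a b c : TangentSpace 𝓘(ℝ, E) x) : TangentSpace 𝓘(ℝ, E) x :=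
  letI A := extend E a
  letI B := extend E b
  letI C := extend E c
  leviCivita g (fun y ↦ leviCivita g C y (B y)) x a
    - leviCivita g (fun y ↦ leviCivita g C y (A y)) x b
    - leviCivita g C x (VectorField.mlieBracket 𝓘(ℝ, E) A B x)

/-- The Ricci operator `Ric v = ∑ R(v, e_i) e_i` on tangent vectors. -/
def ricci (x : M) (v : TangentSpace 𝓘(ℝ, E) x) : TangentSpace 𝓘(ℝ, E) x :=
  ∑ i, curvature g x v (onb g x i) (onb g x i)

/-- The Ricci operator `Ric^φ v = ∑ R^N(v, dφ(e_i)) dφ(e_i)` along `φ`. -/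
def ricciAlong (x : M) (v : PullbackTangent φ x) : PullbackTangent φ x :=
  ∑ i, curvature h (φ x) v (differential φ x (onb g x i))
    (differential φ x (onb g x i))

/-- The trace `tr D² σ = ∑ (D_{e_i} D_{e_i} σ - D_{∇_{e_i} e_i} σ)` at `x` of the second covariant
derivative of a section `σ` of a vector bundle with connection `D`, where the `e_i` are local vector
fields that form an orthonormal basis at `x` (the value does not depend on their choice). -/
def roughLaplacian {F : Type*} [NormedAddCommGroup F] [NormedSpace ℝ F]
    {V : M → Type*} [TopologicalSpace (TotalSpace F V)]
    [∀ x, AddCommGroup (V x)] [∀ x, Module ℝ (V x)] [∀ x, TopologicalSpace (V x)]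
    [∀ x, IsTopologicalAddGroup (V x)] [∀ x, ContinuousSMul ℝ (V x)] [FiberBundle F V]
    (D : CovariantDerivative 𝓘(ℝ, E) F V) (σ : Π x : M, V x) (x : M) : V x :=
  ∑ i, letI e := extend E (onb g x i)
    (D (fun y ↦ D σ y (e y)) x (e x) - D σ x (leviCivita g e x (e x)))

end Maps

end RiemMap

end

/-
Write `D²σ(a, b)` for the second covariant derivative of a section. Its antisymmetric part is the
curvature, for `φ⁻¹TN` as well as for `TM`: on `φ⁻¹TN` both sides are pointwise in `σ`, so it is
enough to look at sections `W ∘ φ`, for which the claim is the one on `N`. Differentiating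
`∇^φ_Y (dφ Z) = dφ(∇_Y Z) + ∇dφ(Y, Z)` once more gives
`D²(dφ Z)(X, Y) = dφ(D²Z(X, Y)) + (∇_X ∇dφ)(Y, Z) + ∇dφ(X, ∇_Y Z) + ∇dφ(Y, ∇_X Z)`,
whose antisymmetric part is the Codazzi equation for `φ`. For `X = Y = e_i` and `Z = V`, the latter
turns `(∇_{e_i} ∇dφ)(V, e_i)` into `(∇_V ∇dφ)(e_i, e_i)` at the cost of the two curvature terms. The
sum of these over an orthonormal frame is `∇^φ_V τ(φ)`: the remaining terms
`2 ∇dφ(∇_V e_i, e_i)` cancel because `⟨∇_V e_i, e_j⟩` is skew and `∇dφ` is symmetric.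
-/

noncomputable section

namespace RiemMap

section Calculus

variable {E : Type*} [NormedAddCommGroup E] [NormedSpace ℝ E]
  {M : Type*} [TopologicalSpace M] [ChartedSpace E M]
  {G : Type*} [NormedAddCommGroup G] [NormedSpace ℝ G] {f : M → G} {x : M}

theorem contDiffAt_comp_extChartAt_symm (hf : CMDiffAt ∞ f x) :
    ContDiffAt ℝ ∞ (f ∘ (extChartAt 𝓘(ℝ, E) x).symm) (extChartAt 𝓘(ℝ, E) x x) := by
  have h := contMDiffAt_iff_source.1 hf
  rwa [modelWithCornersSelf_coe, Set.range_id, contMDiffWithinAt_univ,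
    contMDiffAt_iff_contDiffAt] at h

theorem two_le_infty : (2 : ℕ∞ω) ≤ ∞ := ENat.LEInfty.out

variable [IsManifold 𝓘(ℝ, E) ∞ M]

theorem eventually_mdifferentiableAt (hf : CMDiffAt ∞ f x) : ∀ᶠ y in nhds x, MDiffAt f y := by
  have : IsManifold 𝓘(ℝ, E) 1 M := .of_le (n := ∞) (by simp)
  exact ((contMDiffAt_iff_contMDiffAt_nhds (n := 1) (by simp)).1 (hf.of_le (by simp))).mono
    fun _ hy ↦ hy.mdifferentiableAt (by simp)

theorem contMDiffAt_mvfderiv_apply {X : Π x : M, TangentSpace 𝓘(ℝ, E) x}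
    (hf : CMDiffAt ∞ f x) (hX : CMDiffAt ∞ (T% X) x) :
    CMDiffAt ∞ (fun y ↦ mvfderiv 𝓘(ℝ, E) f y (X y)) x := by
  have hdf : ContMDiffAt 𝓘(ℝ, E) (𝓘(ℝ, E).prod 𝓘(ℝ, E →L[ℝ] G)) ∞
      (fun y ↦ TotalSpace.mk' (E →L[ℝ] G)
        (E := fun y : M ↦ (TangentSpace 𝓘(ℝ, E) y →L[ℝ] Bundle.Trivial M G y)) y
        (mvfderiv 𝓘(ℝ, E) f y)) x := by
    rw [contMDiffAt_hom_bundle]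
    refine ⟨contMDiffAt_id, (hf.mfderiv_const (m := ∞) (by simp)).congr_of_eventuallyEq ?_⟩
    refine Filter.Eventually.of_forall fun y ↦ ?_
    ext v
    simp only [inTangentCoordinates, ContinuousLinearMap.inCoordinates, mvfderiv,
      Trivial.fiberBundle_trivializationAt', Trivial.continuousLinearMapAt_trivialization,
      ContinuousLinearMap.id_comp, ContinuousLinearMap.comp_apply,
      ContinuousLinearEquiv.coe_coe, TangentBundle.continuousLinearMapAt_model_space, id_eq]
    rfl
  exact (contMDiffAt_totalSpace.1 (hdf.clm_bundle_apply hX)).2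

theorem extend_eq_mfderiv_extChartAt_symm {x y : M} (hy : y ∈ (chartAt E x).source)
    (b : TangentSpace 𝓘(ℝ, E) x) :
    extend E b y = mfderiv 𝓘(ℝ, E) 𝓘(ℝ, E) (extChartAt 𝓘(ℝ, E) x).symm
      (extChartAt 𝓘(ℝ, E) x y) (trivializationAt E (TangentSpace 𝓘(ℝ, E)) x ⟨x, b⟩).2 := by
  have h := TangentBundle.symmL_trivializationAt (I := 𝓘(ℝ, E)) hy
  rw [modelWithCornersSelf_coe, Set.range_id, mfderivWithin_univ] at h
  rw [← h]
  exact (Trivialization.symmL_apply (R := ℝ) _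
    (show y ∈ (trivializationAt E (TangentSpace 𝓘(ℝ, E)) x).baseSet from hy) _).symm

theorem mvfderiv_extend {x y : M} (hy : y ∈ (chartAt E x).source)
    (hf : MDiffAt f y) (b : TangentSpace 𝓘(ℝ, E) x) :
    mvfderiv 𝓘(ℝ, E) f y (extend E b y) =
      fderiv ℝ (f ∘ (extChartAt 𝓘(ℝ, E) x).symm) (extChartAt 𝓘(ℝ, E) x y)
        (trivializationAt E (TangentSpace 𝓘(ℝ, E)) x ⟨x, b⟩).2 := by
  have hy' : y ∈ (extChartAt 𝓘(ℝ, E) x).source := by simpa only [extChartAt_source] using hy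
  have hsymm : MDifferentiableAt 𝓘(ℝ, E) 𝓘(ℝ, E) (extChartAt 𝓘(ℝ, E) x).symm
      (extChartAt 𝓘(ℝ, E) x y) := by
    have := mdifferentiableWithinAt_extChartAt_symm (I := 𝓘(ℝ, E))
      ((extChartAt 𝓘(ℝ, E) x).map_source hy')
    rwa [modelWithCornersSelf_coe, Set.range_id, mdifferentiableWithinAt_univ] at this
  have hinv : (extChartAt 𝓘(ℝ, E) x).symm (extChartAt 𝓘(ℝ, E) x y) = y :=
    (extChartAt 𝓘(ℝ, E) x).left_inv hy'
  rw [extend_eq_mfderiv_extChartAt_symm hy, ← mfderiv_eq_fderiv,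
    mfderiv_comp_of_eq hf hsymm hinv, hinv]
  rfl

theorem mvfderiv_mvfderiv_extend (hf : CMDiffAt ∞ f x) (b c : TangentSpace 𝓘(ℝ, E) x) :
    mvfderiv 𝓘(ℝ, E) (fun y ↦ mvfderiv 𝓘(ℝ, E) f y (extend E b y)) x c =
      fderiv ℝ (fderiv ℝ (f ∘ (extChartAt 𝓘(ℝ, E) x).symm)) (extChartAt 𝓘(ℝ, E) x x)
        (trivializationAt E (TangentSpace 𝓘(ℝ, E)) x ⟨x, c⟩).2
        (trivializationAt E (TangentSpace 𝓘(ℝ, E)) x ⟨x, b⟩).2 := by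
  set ψ := extChartAt 𝓘(ℝ, E) x
  set b' : E := (trivializationAt E (TangentSpace 𝓘(ℝ, E)) x ⟨x, b⟩).2
  have hdf : DifferentiableAt ℝ (fderiv ℝ (f ∘ ψ.symm)) (ψ x) :=
    ((contDiffAt_comp_extChartAt_symm hf).fderiv_right (m := 1) two_le_infty).differentiableAt
      (by simp)
  have first : (fun y ↦ mvfderiv 𝓘(ℝ, E) f y (extend E b y)) =ᶠ[nhds x]
      fun y ↦ fderiv ℝ (f ∘ ψ.symm) (ψ y) b' := by
    filter_upwards [eventually_mdifferentiableAt hf, chart_source_mem_nhds E x] with y hy hyx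
    exact mvfderiv_extend hyx hy b
  have hmd : MDiffAt (fun y ↦ fderiv ℝ (f ∘ ψ.symm) (ψ y) b') x :=
    (hdf.clm_apply (differentiableAt_const b')).mdifferentiableAt.comp x
      (mdifferentiableAt_extChartAt (I := 𝓘(ℝ, E)) (mem_chart_source E x))
  have in_chart : (fun y ↦ fderiv ℝ (f ∘ ψ.symm) (ψ y) b') ∘ ψ.symm =ᶠ[nhds (ψ x)]
      fun u ↦ fderiv ℝ (f ∘ ψ.symm) u b' := by
    filter_upwards [extChartAt_target_mem_nhds (I := 𝓘(ℝ, E)) x] with u hu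
    simp only [Function.comp_apply, ψ.right_inv hu]
  have second := mvfderiv_extend (mem_chart_source E x) hmd c
  rw [extend_apply_self] at second
  rw [mvfderiv_congr first, second, in_chart.fderiv_eq,
    fderiv_clm_apply hdf (differentiableAt_const b')]
  simp

theorem mvfderiv_mvfderiv_extend_comm (hf : CMDiffAt ∞ f x) (b c : TangentSpace 𝓘(ℝ, E) x) :
    mvfderiv 𝓘(ℝ, E) (fun y ↦ mvfderiv 𝓘(ℝ, E) f y (extend E b y)) x c =
      mvfderiv 𝓘(ℝ, E) (fun y ↦ mvfderiv 𝓘(ℝ, E) f y (extend E c y)) x b := by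
  have hsymm := (contDiffAt_comp_extChartAt_symm hf).isSymmSndFDerivAt
    (by simpa using two_le_infty)
  rw [mvfderiv_mvfderiv_extend hf, mvfderiv_mvfderiv_extend hf, hsymm.eq]

end Calculus

section Tensoriality

variable {E : Type*} [NormedAddCommGroup E] [NormedSpace ℝ E]
  {M : Type*} [TopologicalSpace M] [ChartedSpace E M]
  {F : Type*} [NormedAddCommGroup F] [NormedSpace ℝ F]
  {V : M → Type*} [TopologicalSpace (TotalSpace F V)] [∀ x, TopologicalSpace (V x)]
  [FiberBundle F V] {x : M}

theorem contMDiffAt_section_congr {σ τ : Π x : M, V x} (hσ : CMDiffAt ∞ (T% σ) x)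
    (h : ∀ᶠ y in nhds x, τ y = σ y) : CMDiffAt ∞ (T% τ) x :=
  hσ.congr_of_eventuallyEq (h.mono fun y hy ↦ by simp only [hy])

variable [∀ x, AddCommGroup (V x)] [∀ x, Module ℝ (V x)]

theorem eventually_mdifferentiableAt_section [IsManifold 𝓘(ℝ, E) ∞ M] [VectorBundle ℝ F V]
    [ContMDiffVectorBundle ∞ F V 𝓘(ℝ, E)] {σ : Π x : M, V x} (hσ : CMDiffAt ∞ (T% σ) x) :
    ∀ᶠ y in nhds x, MDiffAt (T% σ) y := by
  have : ContMDiffVectorBundle 1 F V 𝓘(ℝ, E) := .of_le (n := ∞) (by simp)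
  exact ((contMDiffAt_iff_contMDiffAt_nhds (n := 1) (by simp)).1 (hσ.of_le (by simp))).mono
    fun y hy ↦ hy.mdifferentiableAt (by simp)

variable {A : Type*} [AddCommGroup A] [Module ℝ A] {Φ : (Π x : M, V x) → A}

variable (E F) in
/-- The operation `Φ` on sections of `V` is tensorial at `x` as far as smooth sections are
concerned. Mathlib's `TensorialAt` tests all differentiable sections, which is too much for
operations of order two: the covariant derivative of a differentiable section need not be
differentiable. -/
structure SmoothTensorialAt (Φ : (Π x : M, V x) → A) (x : M) : Prop where
  smul : ∀ {f : M → ℝ} {σ : Π x : M, V x}, CMDiffAt ∞ f x → CMDiffAt ∞ (T% σ) x →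
    Φ (f • σ) = f x • Φ σ
  add : ∀ {σ τ : Π x : M, V x}, CMDiffAt ∞ (T% σ) x → CMDiffAt ∞ (T% τ) x →
    Φ (σ + τ) = Φ σ + Φ τ

namespace SmoothTensorialAt

theorem congr_of_eventuallyEq (hΦ : SmoothTensorialAt E F Φ x) {σ τ : Π x : M, V x}
    (hσ : CMDiffAt ∞ (T% σ) x) (h : ∀ᶠ y in nhds x, τ y = σ y) : Φ τ = Φ σ := by
  classical
  -- The indicator function of a neighbourhood of `x` is smooth at `x`, so no bump function is
  -- needed to localise.
  set χ : M → ℝ := Set.indicator {y | τ y = σ y} 1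
  have hχ_one : ∀ᶠ y in nhds x, χ y = 1 := h.mono fun y hy ↦ Set.indicator_of_mem hy 1
  have hχ : CMDiffAt ∞ χ x := contMDiffAt_const.congr_of_eventuallyEq hχ_one
  have hcut : χ • τ = χ • σ := by
    funext y
    by_cases hy : τ y = σ y
    · simp [hy]
    · simp [χ, hy]
  have h1 := hΦ.smul hχ hσ
  have h2 := hΦ.smul hχ (contMDiffAt_section_congr hσ h)
  rw [hχ_one.self_of_nhds, one_smul] at h1 h2
  rw [← h1, ← h2, hcut]

variable [VectorBundle ℝ F V]

theorem map_sum_smul (hΦ : SmoothTensorialAt E F Φ x) {ι : Type*} [Fintype ι] {f : ι → M → ℝ}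
    {s : ι → Π x : M, V x} (hf : ∀ i, CMDiffAt ∞ (f i) x) (hs : ∀ i, CMDiffAt ∞ (T% (s i)) x) :
    Φ (fun y ↦ ∑ i, f i y • s i y) = ∑ i, f i x • Φ (s i) := by
  classical
  have key (S : Finset ι) : Φ (fun y ↦ ∑ i ∈ S, f i y • s i y) = ∑ i ∈ S, f i x • Φ (s i) := by
    induction S using Finset.induction_on with
    | empty =>
      have h0 := hΦ.smul (f := 0) (σ := 0) contMDiffAt_const (contMDiff_zeroSection ℝ V x)
      rw [zero_smul, Pi.zero_apply, zero_smul] at h0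
      simpa only [Finset.sum_empty] using! h0
    | insert i S hi ih =>
      simp only [Finset.sum_insert hi]
      rw [← ih, ← hΦ.smul (hf i) (hs i)]
      exact hΦ.add ((hf i).smul_section (hs i))
        (.sum_section fun j _ ↦ (hf j).smul_section (hs j))
  exact key Finset.univ

theorem pointwise [FiniteDimensional ℝ F] [ContMDiffVectorBundle ∞ F V 𝓘(ℝ, E)]
    (hΦ : SmoothTensorialAt E F Φ x) {σ τ : Π x : M, V x} (hσ : CMDiffAt ∞ (T% σ) x)
    (hτ : CMDiffAt ∞ (T% τ) x) (h : σ x = τ x) : Φ σ = Φ τ := by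
  have : ContMDiffVectorBundle 1 F V 𝓘(ℝ, E) := .of_le (n := ∞) (by simp)
  let t := trivializationAt F V x
  let b := Module.finBasis ℝ F
  have hx : x ∈ t.baseSet := mem_baseSet_trivializationAt F V x
  have expand (ρ : Π x : M, V x) (hρ : CMDiffAt ∞ (T% ρ) x) :
      Φ ρ = ∑ i, t.localFrameCoeff 𝓘(ℝ, E) b i x (ρ x) • Φ (t.localFrame b i) := by
    have hcoeff := (contMDiffAt_iff_localFrameCoeff b hx).1 hρ
    have hframe i := contMDiffAt_localFrame_of_mem (I := 𝓘(ℝ, E)) (V := V) ∞ t b i hx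
    refine Eq.trans ?_ (hΦ.map_sum_smul hcoeff hframe)
    exact (hΦ.congr_of_eventuallyEq hρ ((t.eventually_eq_localFrame_sum_coeff_smul
      (I := 𝓘(ℝ, E)) b hx).mono fun _ ↦ Eq.symm)).symm
  rw [expand σ hσ, expand τ hτ, h]

end SmoothTensorialAt

end Tensoriality

section OrthonormalFamilies

variable {E : Type*} [NormedAddCommGroup E] [NormedSpace ℝ E]
  {M : Type*} [TopologicalSpace M] [ChartedSpace E M] [IsManifold 𝓘(ℝ, E) ∞ M]
  {g : ContMDiffRiemannianMetric 𝓘(ℝ, E) ∞ E (fun x : M ↦ TangentSpace 𝓘(ℝ, E) x)} {x : M}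
  {ι : Type*} [DecidableEq ι]

variable (g x) in
/-- The family `e` of tangent vectors at `x` is orthonormal for the metric `g`. -/
def IsOrthonormal (e : ι → TangentSpace 𝓘(ℝ, E) x) : Prop :=
  ∀ i j, g.inner x (e i) (e j) = if i = j then 1 else 0

theorem inner_sum_smul_eq [Fintype ι] {e : ι → TangentSpace 𝓘(ℝ, E) x}
    (he : IsOrthonormal g x e) (c : ι → ℝ) (j : ι) : g.inner x (∑ i, c i • e i) (e j) = c j := by
  simp [he _ j]

variable [FiniteDimensional ℝ E] {e e' : Fin (Module.finrank ℝ E) → TangentSpace 𝓘(ℝ, E) x}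

theorem sum_inner_smul_eq (he : IsOrthonormal g x e) (w : TangentSpace 𝓘(ℝ, E) x) :
    ∑ i, g.inner x w (e i) • e i = w := by
  have hli : LinearIndependent ℝ e := Fintype.linearIndependent_iff.2 fun c hc j ↦ by
    rw [← inner_sum_smul_eq he c j, hc, map_zero, zero_apply]
  let b := Module.Basis.mk hli (hli.span_eq_top_of_card_eq_finrank' (Fintype.card_fin _)).ge
  have hw : ∑ i, b.repr w i • e i = w := by
    conv_rhs => rw [← b.sum_repr w]
    simp [b]
  have hcoeff (i) : g.inner x w (e i) = b.repr w i := by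
    conv_lhs => rw [← hw]
    exact inner_sum_smul_eq he _ i
  simp only [hcoeff, hw]

variable {W : Type*} [AddCommGroup W] [Module ℝ W]
  (B : TangentSpace 𝓘(ℝ, E) x →ₗ[ℝ] TangentSpace 𝓘(ℝ, E) x →ₗ[ℝ] W)

theorem sum_apply_eq_sum_inner_smul (he : IsOrthonormal g x e)
    (w u : Fin (Module.finrank ℝ E) → TangentSpace 𝓘(ℝ, E) x) :
    ∑ i, B (w i) (u i) = ∑ i, ∑ j, g.inner x (w i) (e j) • B (e j) (u i) := by
  refine Finset.sum_congr rfl fun i _ ↦ ?_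
  conv_lhs => rw [← sum_inner_smul_eq he (w i)]
  simp only [map_sum, map_smul, LinearMap.sum_apply, LinearMap.smul_apply]

theorem sum_apply_self_eq_of_isOrthonormal (he : IsOrthonormal g x e)
    (he' : IsOrthonormal g x e') : ∑ i, B (e i) (e i) = ∑ i, B (e' i) (e' i) := by
  rw [sum_apply_eq_sum_inner_smul B he', Finset.sum_comm]
  refine Finset.sum_congr rfl fun j _ ↦ ?_
  conv_rhs => rw [← congrArg (B (e' j)) (sum_inner_smul_eq he (e' j)), map_sum]
  simp only [map_smul, g.symm x (e' j)]

theorem sum_apply_add_apply_eq_zero_of_skew (he : IsOrthonormal g x e)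
    {w : Fin (Module.finrank ℝ E) → TangentSpace 𝓘(ℝ, E) x}
    (hw : ∀ i j, g.inner x (w i) (e j) = -g.inner x (w j) (e i)) :
    ∑ i, (B (w i) (e i) + B (e i) (w i)) = 0 := by
  have hneg : ∑ i, B (w i) (e i) = -∑ i, B (e i) (w i) := by
    rw [sum_apply_eq_sum_inner_smul B he, Finset.sum_comm, ← Finset.sum_neg_distrib]
    refine Finset.sum_congr rfl fun j _ ↦ ?_
    conv_rhs => rw [← sum_inner_smul_eq he (w j), map_sum, ← Finset.sum_neg_distrib]
    simp only [map_smul, hw _ j, neg_smul]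
  rw [Finset.sum_add_distrib, hneg, neg_add_cancel]

end OrthonormalFamilies

section OrthonormalFrames

variable {E : Type*} [NormedAddCommGroup E] [NormedSpace ℝ E]
  {M : Type*} [TopologicalSpace M] [ChartedSpace E M] [IsManifold 𝓘(ℝ, E) ∞ M]
  {g : ContMDiffRiemannianMetric 𝓘(ℝ, E) ∞ E (fun x : M ↦ TangentSpace 𝓘(ℝ, E) x)} {x : M}
  {ι : Type*} [DecidableEq ι]

variable (g) in
theorem contMDiffAt_inner_along {E' : Type*} [NormedAddCommGroup E'] [NormedSpace ℝ E']
    {M' : Type*} [TopologicalSpace M'] [ChartedSpace E' M'] {f : M' → M} {z : M'}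
    {σ τ : Π z : M', TangentSpace 𝓘(ℝ, E) (f z)}
    (hσ : ContMDiffAt 𝓘(ℝ, E') 𝓘(ℝ, E).tangent ∞ (fun z ↦ TotalSpace.mk' E (f z) (σ z)) z)
    (hτ : ContMDiffAt 𝓘(ℝ, E') 𝓘(ℝ, E).tangent ∞ (fun z ↦ TotalSpace.mk' E (f z) (τ z)) z) :
    CMDiffAt ∞ (fun z ↦ g.inner (f z) (σ z) (τ z)) z := by
  have hf : CMDiffAt ∞ f z := (contMDiffAt_totalSpace.1 hσ).1
  have h : ContMDiffAt 𝓘(ℝ, E') (𝓘(ℝ, E).prod 𝓘(ℝ)) ∞ (fun z ↦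
      TotalSpace.mk' ℝ (E := Bundle.Trivial M ℝ) (f z) (g.inner (f z) (σ z) (τ z))) z :=
    ContMDiffAt.clm_bundle_apply₂ (F₁ := E) (F₂ := E) (g.contMDiff.contMDiffAt.comp z hf) hσ hτ
  exact (contMDiffAt_totalSpace.1 h).2

variable (g) in
theorem contMDiffAt_inner {σ τ : Π x : M, TangentSpace 𝓘(ℝ, E) x}
    (hσ : CMDiffAt ∞ (T% σ) x) (hτ : CMDiffAt ∞ (T% τ) x) :
    CMDiffAt ∞ (fun y ↦ g.inner y (σ y) (τ y)) x :=
  contMDiffAt_inner_along g (f := fun y ↦ y) hσ hτ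

variable (g x) in
/-- A local orthonormal frame at `x`: the vector fields `s i` are smooth at `x` and orthonormal
throughout a neighbourhood of `x`. They are not required to span. -/
structure IsOrthonormalFrameAt (s : ι → Π x : M, TangentSpace 𝓘(ℝ, E) x) : Prop where
  contMDiffAt : ∀ i, CMDiffAt ∞ (T% (s i)) x
  isOrthonormal : ∀ᶠ y in nhds x, IsOrthonormal g y (s · y)

namespace IsOrthonormalFrameAt

variable {s : ι → Π x : M, TangentSpace 𝓘(ℝ, E) x}

theorem isOrthonormal_self (hs : IsOrthonormalFrameAt g x s) : IsOrthonormal g x (s · x) :=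
  hs.isOrthonormal.self_of_nhds

theorem exists_smooth_orthogonal_extension [Finite ι] (hs : IsOrthonormalFrameAt g x s)
    {v : TangentSpace 𝓘(ℝ, E) x} (hv : ∀ i, g.inner x v (s i x) = 0) :
    ∃ p : Π x : M, TangentSpace 𝓘(ℝ, E) x, p x = v ∧ CMDiffAt ∞ (T% p) x ∧
      ∀ᶠ y in nhds x, ∀ i, g.inner y (p y) (s i y) = 0 := by
  have := Fintype.ofFinite ι
  have hext : CMDiffAt ∞ (T% (extend E v)) x := contMDiffAt_extend 𝓘(ℝ, E) E v
  refine ⟨fun y ↦ extend E v y - ∑ i, g.inner y (extend E v y) (s i y) • s i y, ?_, ?_, ?_⟩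
  · simp [hv]
  · exact hext.sub_section (.sum_section fun i _ ↦
      (contMDiffAt_inner g hext (hs.contMDiffAt i)).smul_section (hs.contMDiffAt i))
  · filter_upwards [hs.isOrthonormal] with y hy i
    rw [map_sub, sub_apply, inner_sum_smul_eq hy, sub_self]

theorem exists_smooth_unit_orthogonal_extension [Finite ι] (hs : IsOrthonormalFrameAt g x s)
    {v : TangentSpace 𝓘(ℝ, E) x} (hv : ∀ i, g.inner x v (s i x) = 0) (hv1 : g.inner x v v = 1) :
    ∃ u : Π x : M, TangentSpace 𝓘(ℝ, E) x, u x = v ∧ CMDiffAt ∞ (T% u) x ∧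
      (∀ᶠ y in nhds x, ∀ i, g.inner y (u y) (s i y) = 0) ∧
      ∀ᶠ y in nhds x, g.inner y (u y) (u y) = 1 := by
  obtain ⟨p, rfl, hp, hps⟩ := hs.exists_smooth_orthogonal_extension hv
  have hnorm := contMDiffAt_inner g hp hp
  refine ⟨fun y ↦ (√(g.inner y (p y) (p y)))⁻¹ • p y, by simp [hv1], ?_, ?_, ?_⟩
  · have hsqrt : CMDiffAt ∞ (fun y ↦ √(g.inner y (p y) (p y))) x :=
      (Real.contDiffAt_sqrt (by simp [hv1])).contMDiffAt.comp x hnorm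
    exact (hsqrt.inv₀ (by simp [hv1])).smul_section hp
  · filter_upwards [hps] with y hy i
    simp [hy i]
  · have hpos : ∀ᶠ y in nhds x, 0 < g.inner y (p y) (p y) :=
      hnorm.continuousAt.eventually_const_lt (by simp [hv1])
    filter_upwards [hpos] with y hy
    simp only [map_smul, smul_apply, smul_eq_mul]
    rw [← mul_assoc, ← mul_inv, Real.mul_self_sqrt hy.le, inv_mul_cancel₀ hy.ne']

end IsOrthonormalFrameAt

theorem exists_isOrthonormalFrameAt_extending {k : ℕ} {e : Fin k → TangentSpace 𝓘(ℝ, E) x}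
    (he : IsOrthonormal g x e) : ∃ s : Fin k → Π x : M, TangentSpace 𝓘(ℝ, E) x,
      IsOrthonormalFrameAt g x s ∧ ∀ i, s i x = e i := by
  induction k with
  | zero => exact ⟨Fin.elim0, ⟨fun i ↦ i.elim0, .of_forall fun _ i ↦ i.elim0⟩, fun i ↦ i.elim0⟩
  | succ k ih =>
    obtain ⟨s, hs, hse⟩ := ih (e := fun i ↦ e i.castSucc) fun i j ↦ by
      simp [he i.castSucc j.castSucc]
    obtain ⟨u, hux, hu, hus, huu⟩ := hs.exists_smooth_unit_orthogonal_extension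
      (v := e (Fin.last k)) (fun i ↦ by simp [hse, he (Fin.last k) _, i.castSucc_ne_last.symm])
      (by simp [he (Fin.last k) _])
    refine ⟨Fin.snoc s u, ⟨fun i ↦ ?_, ?_⟩, fun i ↦ ?_⟩
    · cases i using Fin.lastCases with
      | last => simpa only [Fin.snoc_last] using hu
      | cast i => simpa only [Fin.snoc_castSucc] using hs.contMDiffAt i
    · filter_upwards [hs.isOrthonormal, hus, huu] with y hys hyus hyuu i j
      cases i using Fin.lastCases <;> cases j using Fin.lastCases
      · simpa using hyuu
      · simpa [(Fin.castSucc_ne_last _).symm] using! hyus _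
      · simpa [g.symm y _ (u y)] using! hyus _
      · simpa using! hys _ _
    · cases i using Fin.lastCases with
      | last => simpa only [Fin.snoc_last] using hux
      | cast i => simpa only [Fin.snoc_castSucc] using hse i

variable [FiniteDimensional ℝ E]

variable (g x) in
theorem exists_isOrthonormalFrameAt : ∃ s : Fin (Module.finrank ℝ E) →
    Π x : M, TangentSpace 𝓘(ℝ, E) x, IsOrthonormalFrameAt g x s ∧ ∀ i, s i x = onb g x i :=
  exists_isOrthonormalFrameAt_extending (onb_orthonormal g x)

end OrthonormalFrames

section MLieBracket

variable {E : Type*} [NormedAddCommGroup E] [NormedSpace ℝ E] [CompleteSpace E]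
  {M : Type*} [TopologicalSpace M] [ChartedSpace E M] [IsManifold 𝓘(ℝ, E) ∞ M] {x : M}
  {X Y : Π x : M, TangentSpace 𝓘(ℝ, E) x}

theorem contMDiffAt_mlieBracket (hX : CMDiffAt ∞ (T% X) x) (hY : CMDiffAt ∞ (T% Y) x) :
    CMDiffAt ∞ (T% (VectorField.mlieBracket 𝓘(ℝ, E) X Y)) x := by
  have : IsManifold 𝓘(ℝ, E) (((⊤ : ℕ∞) : ℕ∞ω) + 1) M := .of_le (n := ∞) (by simp)
  have : IsManifold 𝓘(ℝ, E) (minSmoothness ℝ 2) M := .of_le (n := ∞) (by simpa using two_le_infty)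
  exact ContMDiffAt.mlieBracket_vectorField (n := ⊤) (m := ⊤) hX hY (by simp)

end MLieBracket

section LeviCivitaSmooth

variable {E : Type*} [NormedAddCommGroup E] [NormedSpace ℝ E] [FiniteDimensional ℝ E]
  {M : Type*} [TopologicalSpace M] [ChartedSpace E M] [IsManifold 𝓘(ℝ, E) ∞ M]
  (g : ContMDiffRiemannianMetric 𝓘(ℝ, E) ∞ E (fun x : M ↦ TangentSpace 𝓘(ℝ, E) x)) {x : M}
  {X Y Z : Π x : M, TangentSpace 𝓘(ℝ, E) x}

theorem contMDiffAt_of_contMDiffAt_inner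
    (h : ∀ Z : Π x : M, TangentSpace 𝓘(ℝ, E) x, CMDiffAt ∞ (T% Z) x →
      CMDiffAt ∞ (fun y ↦ g.inner y (X y) (Z y)) x) : CMDiffAt ∞ (T% X) x := by
  obtain ⟨s, hs, -⟩ := exists_isOrthonormalFrameAt g x
  have hsum : CMDiffAt ∞ (T% (fun y ↦ ∑ i, g.inner y (X y) (s i y) • s i y)) x :=
    .sum_section fun i _ ↦ (h _ (hs.contMDiffAt i)).smul_section (hs.contMDiffAt i)
  refine contMDiffAt_section_congr hsum ?_
  filter_upwards [hs.isOrthonormal] with y hy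
  exact (sum_inner_smul_eq hy (X y)).symm

theorem leviCivita_sub_eq_mlieBracket (hX : MDiffAt (T% X) x) (hY : MDiffAt (T% Y) x) :
    leviCivita g Y x (X x) - leviCivita g X x (Y x) = VectorField.mlieBracket 𝓘(ℝ, E) X Y x :=
  (leviCivita g).torsion_eq_zero_iff.1 (leviCivita_torsion g) hX hY

theorem koszul_formula (hX : MDiffAt (T% X) x) (hY : MDiffAt (T% Y) x) (hZ : MDiffAt (T% Z) x) :
    g.inner x (leviCivita g Y x (X x)) (Z x) = (1 / 2 : ℝ) *
      (mvfderiv 𝓘(ℝ, E) (fun y ↦ g.inner y (Y y) (Z y)) x (X x)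
        + mvfderiv 𝓘(ℝ, E) (fun y ↦ g.inner y (X y) (Z y)) x (Y x)
        - mvfderiv 𝓘(ℝ, E) (fun y ↦ g.inner y (X y) (Y y)) x (Z x)
        + g.inner x (VectorField.mlieBracket 𝓘(ℝ, E) X Y x) (Z x)
        - g.inner x (VectorField.mlieBracket 𝓘(ℝ, E) X Z x) (Y x)
        - g.inner x (VectorField.mlieBracket 𝓘(ℝ, E) Y Z x) (X x)) := by
  rw [leviCivita_metric g hY hZ, leviCivita_metric g hX hZ, leviCivita_metric g hX hY,
    ← leviCivita_sub_eq_mlieBracket g hX hY, ← leviCivita_sub_eq_mlieBracket g hX hZ,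
    ← leviCivita_sub_eq_mlieBracket g hY hZ]
  simp only [map_sub, sub_apply]
  rw [g.symm x (leviCivita g Z x (X x)) (Y x), g.symm x (leviCivita g X x (Z x)) (Y x),
    g.symm x (leviCivita g Z x (Y x)) (X x), g.symm x (leviCivita g Y x (Z x)) (X x)]
  ring

theorem contMDiffAt_leviCivita (hX : CMDiffAt ∞ (T% X) x) (hY : CMDiffAt ∞ (T% Y) x) :
    CMDiffAt ∞ (T% (fun y ↦ leviCivita g Y y (X y))) x := by
  refine contMDiffAt_of_contMDiffAt_inner g fun Z hZ ↦ ?_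
  have hinner_deriv {P Q R : Π x : M, TangentSpace 𝓘(ℝ, E) x} (hP : CMDiffAt ∞ (T% P) x)
      (hQ : CMDiffAt ∞ (T% Q) x) (hR : CMDiffAt ∞ (T% R) x) :
      CMDiffAt ∞ (fun y ↦ mvfderiv 𝓘(ℝ, E) (fun y ↦ g.inner y (P y) (Q y)) y (R y)) x :=
    contMDiffAt_mvfderiv_apply (contMDiffAt_inner g hP hQ) hR
  have hinner_bracket {P Q R : Π x : M, TangentSpace 𝓘(ℝ, E) x} (hP : CMDiffAt ∞ (T% P) x)
      (hQ : CMDiffAt ∞ (T% Q) x) (hR : CMDiffAt ∞ (T% R) x) :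
      CMDiffAt ∞ (fun y ↦ g.inner y (VectorField.mlieBracket 𝓘(ℝ, E) P Q y) (R y)) x :=
    contMDiffAt_inner g (contMDiffAt_mlieBracket hP hQ) hR
  have hkoszul := contMDiffAt_const (c := (1 / 2 : ℝ)) |>.mul <|
    (hinner_deriv hY hZ hX).add (hinner_deriv hX hZ hY) |>.sub (hinner_deriv hX hY hZ)
      |>.add (hinner_bracket hX hY hZ) |>.sub (hinner_bracket hX hZ hY)
      |>.sub (hinner_bracket hY hZ hX)
  refine hkoszul.congr_of_eventuallyEq ?_
  filter_upwards [eventually_mdifferentiableAt_section hX, eventually_mdifferentiableAt_section hY,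
    eventually_mdifferentiableAt_section hZ] with y hXy hYy hZy
  exact koszul_formula g hXy hYy hZy

end LeviCivitaSmooth

section Connections

variable {E : Type*} [NormedAddCommGroup E] [NormedSpace ℝ E]
  {M : Type*} [TopologicalSpace M] [ChartedSpace E M]
  {F : Type*} [NormedAddCommGroup F] [NormedSpace ℝ F]
  {V : M → Type*} [TopologicalSpace (TotalSpace F V)]
  [∀ x, AddCommGroup (V x)] [∀ x, Module ℝ (V x)] [∀ x, TopologicalSpace (V x)]
  [∀ x, IsTopologicalAddGroup (V x)] [∀ x, ContinuousSMul ℝ (V x)] [FiberBundle F V]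
  (D : CovariantDerivative 𝓘(ℝ, E) F V) {x : M} {σ τ : Π x : M, V x}

theorem conn_congr (hσ : MDiffAt (T% σ) x) (h : ∀ᶠ y in nhds x, τ y = σ y) : D τ x = D σ x :=
  D.isCovariantDerivativeOnUniv.congr_of_eventuallyEq
    (hσ.congr_of_eventuallyEq (h.mono fun y hy ↦ by simp only [hy])) hσ Filter.univ_mem h

theorem conn_add (hσ : MDiffAt (T% σ) x) (hτ : MDiffAt (T% τ) x) (v : TangentSpace 𝓘(ℝ, E) x) :
    D (σ + τ) x v = D σ x v + D τ x v :=
  congrArg (· v) (D.isCovariantDerivativeOnUniv.add hσ hτ)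

theorem conn_smul {f : M → ℝ} (hf : MDiffAt f x) (hσ : MDiffAt (T% σ) x)
    (v : TangentSpace 𝓘(ℝ, E) x) :
    D (f • σ) x v = mvfderiv 𝓘(ℝ, E) f x v • σ x + f x • D σ x v := by
  rw [D.isCovariantDerivativeOnUniv.leibniz hσ hf]
  simp [add_comm]

theorem conn_sum [VectorBundle ℝ F V] {ι : Type*} (S : Finset ι) {σ : ι → Π x : M, V x}
    (hσ : ∀ i, MDiffAt (T% (σ i)) x) (v : TangentSpace 𝓘(ℝ, E) x) :
    D (fun y ↦ ∑ i ∈ S, σ i y) x v = ∑ i ∈ S, D (σ i) x v := by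
  classical
  induction S using Finset.induction_on with
  | empty => exact congrArg (· v) (D.isCovariantDerivativeOnUniv.zero (x := x))
  | insert i S hi ih =>
    simp only [Finset.sum_insert hi]
    rw [← ih]
    exact conn_add D (hσ i) (.sum_section fun i _ ↦ hσ i) v

variable [IsManifold 𝓘(ℝ, E) ∞ M]

/-- The connection `D` preserves smoothness of germs: if `σ` and `X` are smooth at `x`, then so is
`D_X σ`. -/
def IsSmoothConnection : Prop :=
  ∀ {x : M} {σ : Π x : M, V x} {X : Π x : M, TangentSpace 𝓘(ℝ, E) x},
    CMDiffAt ∞ (T% σ) x → CMDiffAt ∞ (T% X) x → CMDiffAt ∞ (T% (fun y ↦ D σ y (X y))) x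

end Connections

section SecondCovariantDerivative

variable {E : Type*} [NormedAddCommGroup E] [NormedSpace ℝ E] [FiniteDimensional ℝ E]
  {M : Type*} [TopologicalSpace M] [ChartedSpace E M] [IsManifold 𝓘(ℝ, E) ∞ M]
  {F : Type*} [NormedAddCommGroup F] [NormedSpace ℝ F]
  {V : M → Type*} [TopologicalSpace (TotalSpace F V)]
  [∀ x, AddCommGroup (V x)] [∀ x, Module ℝ (V x)] [∀ x, TopologicalSpace (V x)]
  [∀ x, IsTopologicalAddGroup (V x)] [∀ x, ContinuousSMul ℝ (V x)] [FiberBundle F V]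
  (g : ContMDiffRiemannianMetric 𝓘(ℝ, E) ∞ E (fun x : M ↦ TangentSpace 𝓘(ℝ, E) x))
  (D : CovariantDerivative 𝓘(ℝ, E) F V) {x : M} {σ : Π x : M, V x}

/-- The second covariant derivative `D²σ(a, b) = D_a D_B σ - D_{∇_a B} σ` at `x`, where `B` is a
local vector field with `B(x) = b`. -/
def secondCovariantDeriv (σ : Π x : M, V x) (x : M) (a b : TangentSpace 𝓘(ℝ, E) x) : V x :=
  D (fun y ↦ D σ y (extend E b y)) x a - D σ x (leviCivita g (extend E b) x a)

theorem roughLaplacian_eq_sum (σ : Π x : M, V x) (x : M) : roughLaplacian g D σ x =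
    ∑ i, secondCovariantDeriv g D σ x (onb g x i) (onb g x i) := by
  simp only [roughLaplacian, secondCovariantDeriv, extend_apply_self]

theorem leviCivita_extend_comm (a b : TangentSpace 𝓘(ℝ, E) x) :
    leviCivita g (extend E b) x a = leviCivita g (extend E a) x b := by
  have h := leviCivita_sub_eq_mlieBracket g (mdifferentiableAt_extend 𝓘(ℝ, E) E a)
    (mdifferentiableAt_extend 𝓘(ℝ, E) E b)
  rwa [mlieBracket_extend, extend_apply_self, extend_apply_self, sub_eq_zero] at h

variable {D}

theorem secondCovariantDeriv_eq (hD : IsSmoothConnection D) (hσ : CMDiffAt ∞ (T% σ) x)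
    {Y : Π x : M, TangentSpace 𝓘(ℝ, E) x} (hY : CMDiffAt ∞ (T% Y) x)
    (a : TangentSpace 𝓘(ℝ, E) x) : secondCovariantDeriv g D σ x a (Y x) =
      D (fun y ↦ D σ y (Y y)) x a - D σ x (leviCivita g Y x a) := by
  let Φ (Y : Π x : M, TangentSpace 𝓘(ℝ, E) x) : V x :=
    D (fun y ↦ D σ y (Y y)) x a - D σ x (leviCivita g Y x a)
  have hΦ : SmoothTensorialAt E E Φ x :=
    { smul := fun {f Y} hf hY ↦ by
        have hf' : MDiffAt f x := hf.mdifferentiableAt (by simp)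
        have hfield : (fun y ↦ D σ y ((f • Y) y)) = f • fun y ↦ D σ y (Y y) := by
          funext y
          exact map_smul _ _ _
        simp only [Φ]
        rw [hfield, conn_smul D hf' ((hD hσ hY).mdifferentiableAt (by simp)),
          conn_smul (leviCivita g) hf' (hY.mdifferentiableAt (by simp)), map_add, map_smul,
          map_smul]
        module
      add := fun {Y Z} hY hZ ↦ by
        have hfield : (fun y ↦ D σ y ((Y + Z) y)) =
            (fun y ↦ D σ y (Y y)) + fun y ↦ D σ y (Z y) := by
          funext y
          exact map_add _ _ _
        simp only [Φ]
        rw [hfield, conn_add D ((hD hσ hY).mdifferentiableAt (by simp))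
            ((hD hσ hZ).mdifferentiableAt (by simp)),
          conn_add (leviCivita g) (hY.mdifferentiableAt (by simp))
            (hZ.mdifferentiableAt (by simp)), map_add]
        module }
  exact hΦ.pointwise (contMDiffAt_extend 𝓘(ℝ, E) E (Y x)) hY (extend_apply_self ..)

variable [VectorBundle ℝ F V] [ContMDiffVectorBundle ∞ F V 𝓘(ℝ, E)]

theorem secondCovariantDeriv_add (hD : IsSmoothConnection D) {τ : Π x : M, V x}
    (hσ : CMDiffAt ∞ (T% σ) x) (hτ : CMDiffAt ∞ (T% τ) x) (a b : TangentSpace 𝓘(ℝ, E) x) :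
    secondCovariantDeriv g D (σ + τ) x a b =
      secondCovariantDeriv g D σ x a b + secondCovariantDeriv g D τ x a b := by
  have hB : CMDiffAt ∞ (T% (extend E b)) x := contMDiffAt_extend 𝓘(ℝ, E) E b
  have hnear : ∀ᶠ y in nhds x, D (σ + τ) y (extend E b y) =
      ((fun y ↦ D σ y (extend E b y)) + fun y ↦ D τ y (extend E b y)) y := by
    filter_upwards [eventually_mdifferentiableAt_section hσ,
      eventually_mdifferentiableAt_section hτ] with y hσy hτy
    exact conn_add D hσy hτy _
  have hDσ := (hD hσ hB).mdifferentiableAt (by simp)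
  have hDτ := (hD hτ hB).mdifferentiableAt (by simp)
  simp only [secondCovariantDeriv]
  rw [conn_congr D (mdifferentiableAt_add_section hDσ hDτ) hnear, conn_add D hDσ hDτ,
    conn_add D (hσ.mdifferentiableAt (by simp)) (hτ.mdifferentiableAt (by simp))]
  module

theorem secondCovariantDeriv_smul (hD : IsSmoothConnection D) {f : M → ℝ}
    (hf : CMDiffAt ∞ f x) (hσ : CMDiffAt ∞ (T% σ) x) (a b : TangentSpace 𝓘(ℝ, E) x) :
    secondCovariantDeriv g D (f • σ) x a b =
      (mvfderiv 𝓘(ℝ, E) (fun y ↦ mvfderiv 𝓘(ℝ, E) f y (extend E b y)) x a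
        - mvfderiv 𝓘(ℝ, E) f x (leviCivita g (extend E b) x a)) • σ x
      + mvfderiv 𝓘(ℝ, E) f x b • D σ x a + mvfderiv 𝓘(ℝ, E) f x a • D σ x b
      + f x • secondCovariantDeriv g D σ x a b := by
  have hB : CMDiffAt ∞ (T% (extend E b)) x := contMDiffAt_extend 𝓘(ℝ, E) E b
  have hBf := contMDiffAt_mvfderiv_apply hf hB
  have hnear : ∀ᶠ y in nhds x, D (f • σ) y (extend E b y) =
      ((fun y ↦ mvfderiv 𝓘(ℝ, E) f y (extend E b y)) • σ + f • fun y ↦ D σ y (extend E b y)) y := by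
    filter_upwards [eventually_mdifferentiableAt_section hσ,
      eventually_mdifferentiableAt hf] with y hσy hfy
    exact conn_smul D hfy hσy _
  have hσ' := hσ.mdifferentiableAt (by simp)
  have hf' := hf.mdifferentiableAt (by simp)
  have hBf' := hBf.mdifferentiableAt (by simp)
  have hDσ := (hD hσ hB).mdifferentiableAt (by simp)
  simp only [secondCovariantDeriv]
  have h1 := hBf'.smul_section hσ'
  have h2 := hf'.smul_section hDσ
  rw [conn_congr D (mdifferentiableAt_add_section h1 h2) hnear, conn_add D h1 h2,
    conn_smul D hBf' hσ', conn_smul D hf' hDσ, conn_smul D hf' hσ', extend_apply_self]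
  module

theorem smoothTensorialAt_secondCovariantDeriv_sub (hD : IsSmoothConnection D)
    (a b : TangentSpace 𝓘(ℝ, E) x) : SmoothTensorialAt E F (fun σ ↦
      secondCovariantDeriv g D σ x a b - secondCovariantDeriv g D σ x b a) x where
  smul hf hσ := by
    rw [secondCovariantDeriv_smul g hD hf hσ, secondCovariantDeriv_smul g hD hf hσ,
      mvfderiv_mvfderiv_extend_comm hf b a, leviCivita_extend_comm g a b]
    module
  add hσ hτ := by
    rw [secondCovariantDeriv_add g hD hσ hτ, secondCovariantDeriv_add g hD hσ hτ]
    module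

end SecondCovariantDerivative

section Curvature

variable {E : Type*} [NormedAddCommGroup E] [NormedSpace ℝ E] [FiniteDimensional ℝ E]
  {M : Type*} [TopologicalSpace M] [ChartedSpace E M] [IsManifold 𝓘(ℝ, E) ∞ M]
  (g : ContMDiffRiemannianMetric 𝓘(ℝ, E) ∞ E (fun x : M ↦ TangentSpace 𝓘(ℝ, E) x)) {x : M}

theorem isSmoothConnection_leviCivita : IsSmoothConnection (leviCivita g) :=
  fun hY hX ↦ contMDiffAt_leviCivita g hX hY

theorem curvature_eq_secondCovariantDeriv_sub {V : Π x : M, TangentSpace 𝓘(ℝ, E) x}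
    (hV : CMDiffAt ∞ (T% V) x) (a b : TangentSpace 𝓘(ℝ, E) x) : curvature g x a b (V x) =
      secondCovariantDeriv g (leviCivita g) V x a b -
        secondCovariantDeriv g (leviCivita g) V x b a := by
  have hpoint := (smoothTensorialAt_secondCovariantDeriv_sub g (isSmoothConnection_leviCivita g)
    a b).pointwise (contMDiffAt_extend 𝓘(ℝ, E) E (V x)) hV (extend_apply_self ..)
  rw [← hpoint]
  simp only [curvature, secondCovariantDeriv, mlieBracket_extend, map_zero,
    leviCivita_extend_comm g a b]
  module

end Curvature

section PullbackSections

variable {E : Type*} [NormedAddCommGroup E] [NormedSpace ℝ E]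
  {M : Type*} [TopologicalSpace M] [ChartedSpace E M]
  {F : Type*} [NormedAddCommGroup F] [NormedSpace ℝ F]
  {N : Type*} [TopologicalSpace N] [ChartedSpace F N]
  (φ : C^∞⟮𝓘(ℝ, E), M; 𝓘(ℝ, F), N⟯) {x : M}

theorem eventually_comp {p : N → Prop} (hp : ∀ᶠ y in nhds (φ x), p y) :
    ∀ᶠ z in nhds x, p (φ z) :=
  φ.contMDiff.continuous.continuousAt.eventually hp

variable [IsManifold 𝓘(ℝ, F) ∞ N] {σ τ : Π z : M, PullbackTangent φ z}
  {W : Π y : N, TangentSpace 𝓘(ℝ, F) y}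

instance pullbackTangent_contMDiffVectorBundle :
    ContMDiffVectorBundle ∞ F (PullbackTangent φ) 𝓘(ℝ, E) :=
  ContMDiffVectorBundle.pullback F (fun y : N ↦ TangentSpace 𝓘(ℝ, F) y) 𝓘(ℝ, E) φ

/-- The section `σ` of `φ⁻¹TN` is smooth at `x`. -/
abbrev SmoothAlong (σ : Π z : M, PullbackTangent φ z) (x : M) : Prop :=
  ContMDiffAt 𝓘(ℝ, E) (𝓘(ℝ, E).prod 𝓘(ℝ, F)) ∞
    (fun z ↦ TotalSpace.mk' F (E := PullbackTangent φ) z (σ z)) x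

/-- The section `W ∘ φ` of `φ⁻¹TN` defined by a vector field `W` on `N`. -/
def pullSection (W : Π y : N, TangentSpace 𝓘(ℝ, F) y) : Π z : M, PullbackTangent φ z :=
  fun z ↦ W (φ z)

variable {φ} in
theorem smoothAlong_congr (hσ : SmoothAlong φ σ x) (h : ∀ᶠ z in nhds x, τ z = σ z) :
    SmoothAlong φ τ x :=
  contMDiffAt_section_congr (V := PullbackTangent φ) hσ h

theorem smoothAlong_pullSection (hW : CMDiffAt ∞ (T% W) (φ x)) :
    SmoothAlong φ (pullSection φ W) x := by
  have hcoord := (contMDiffAt_section (φ x)).1 hW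
  exact (contMDiffAt_section (E := PullbackTangent φ) x).2
    (ContMDiffAt.comp (I' := 𝓘(ℝ, F)) (f := φ) x hcoord φ.contMDiff.contMDiffAt)

theorem contMDiffAt_totalSpace_comp (hσ : SmoothAlong φ σ x) :
    ContMDiffAt 𝓘(ℝ, E) 𝓘(ℝ, F).tangent ∞
      (fun z ↦ TotalSpace.mk' F (E := fun y : N ↦ TangentSpace 𝓘(ℝ, F) y) (φ z) (σ z)) x :=
  contMDiffAt_totalSpace.2
    ⟨φ.contMDiff.contMDiffAt, (contMDiffAt_section (E := PullbackTangent φ) x).1 hσ⟩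

theorem trivializationAt_push {z : M} (hz : φ z ∈ (chartAt F (φ x)).source)
    (Y : Π x : M, TangentSpace 𝓘(ℝ, E) x) :
    (trivializationAt F (PullbackTangent φ) x ⟨z, push φ Y z⟩).2 =
      mvfderiv 𝓘(ℝ, E) (extChartAt 𝓘(ℝ, F) (φ x) ∘ φ) z (Y z) := by
  have hchart := TangentBundle.continuousLinearMapAt_trivializationAt (I := 𝓘(ℝ, F)) hz
  have hcomp : mvfderiv 𝓘(ℝ, E) (extChartAt 𝓘(ℝ, F) (φ x) ∘ φ) z (Y z) =
      mfderiv 𝓘(ℝ, F) 𝓘(ℝ, F) (extChartAt 𝓘(ℝ, F) (φ x)) (φ z)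
        (mfderiv 𝓘(ℝ, E) 𝓘(ℝ, F) φ z (Y z)) :=
    mfderiv_comp_apply (I' := 𝓘(ℝ, F)) z (mdifferentiableAt_extChartAt hz)
      (φ.contMDiff.mdifferentiableAt (by simp)) _
  rw [hcomp, ← hchart]
  have hz' : φ z ∈ (trivializationAt F (TangentSpace 𝓘(ℝ, F)) (φ x)).baseSet := hz
  exact (Trivialization.continuousLinearMapAt_apply_of_mem (R := ℝ) _ hz' _).symm

section Frame

variable {h : ContMDiffRiemannianMetric 𝓘(ℝ, F) ∞ F (fun y : N ↦ TangentSpace 𝓘(ℝ, F) y)}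
  {s : Fin (Module.finrank ℝ F) → Π y : N, TangentSpace 𝓘(ℝ, F) y}

theorem contMDiffAt_frameCoeff_along (hs : IsOrthonormalFrameAt h (φ x) s)
    (hσ : SmoothAlong φ σ x) (j : Fin (Module.finrank ℝ F)) :
    CMDiffAt ∞ (fun z ↦ h.inner (φ z) (σ z) (s j (φ z))) x :=
  contMDiffAt_inner_along h (contMDiffAt_totalSpace_comp φ hσ)
    (contMDiffAt_totalSpace_comp φ (smoothAlong_pullSection φ (hs.contMDiffAt j)))

theorem eventually_eq_sum_frame_along [FiniteDimensional ℝ F] (hs : IsOrthonormalFrameAt h (φ x) s)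
    (σ : Π z : M, PullbackTangent φ z) : ∀ᶠ z in nhds x,
      σ z = ∑ j, h.inner (φ z) (σ z) (s j (φ z)) • pullSection φ (s j) z := by
  filter_upwards [eventually_comp φ hs.isOrthonormal] with z hz
  exact (sum_inner_smul_eq hz (σ z)).symm

end Frame

variable [IsManifold 𝓘(ℝ, E) ∞ M]

theorem contMDiffAt_differential :
    ContMDiffAt 𝓘(ℝ, E) (𝓘(ℝ, E).prod 𝓘(ℝ, E →L[ℝ] F)) ∞
      (fun y ↦ TotalSpace.mk' (E →L[ℝ] F)
        (E := fun y : M ↦ (TangentSpace 𝓘(ℝ, E) y →L[ℝ] PullbackTangent φ y)) y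
        (differential φ y)) x := by
  rw [contMDiffAt_hom_bundle]
  refine ⟨contMDiffAt_id,
    (φ.contMDiff.contMDiffAt.mfderiv_const (m := ∞) (by simp)).congr_of_eventuallyEq ?_⟩
  refine Filter.Eventually.of_forall fun y ↦ ?_
  ext v
  simp only [inTangentCoordinates, ContinuousLinearMap.inCoordinates, pullback_trivializationAt',
    ContinuousLinearMap.comp_apply, Trivialization.continuousLinearMapAt_apply, id_eq]
  rfl

variable {X : Π x : M, TangentSpace 𝓘(ℝ, E) x}

theorem smoothAlong_push (hX : CMDiffAt ∞ (T% X) x) : SmoothAlong φ (push φ X) x :=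
  (contMDiffAt_differential φ).clm_bundle_apply hX

theorem mdifferentiableAt_push (hX : MDiffAt (T% X) x) :
    MDifferentiableAt 𝓘(ℝ, E) (𝓘(ℝ, E).prod 𝓘(ℝ, F))
      (fun z ↦ TotalSpace.mk' F (E := PullbackTangent φ) z (push φ X z)) x :=
  ((contMDiffAt_differential φ).mdifferentiableAt (by simp)).clm_bundle_apply hX

end PullbackSections

section PullbackConnection

variable {E : Type*} [NormedAddCommGroup E] [NormedSpace ℝ E]
  {M : Type*} [TopologicalSpace M] [ChartedSpace E M]
  {F : Type*} [NormedAddCommGroup F] [NormedSpace ℝ F] [FiniteDimensional ℝ F]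
  {N : Type*} [TopologicalSpace N] [ChartedSpace F N] [IsManifold 𝓘(ℝ, F) ∞ N]
  (h : ContMDiffRiemannianMetric 𝓘(ℝ, F) ∞ F (fun y : N ↦ TangentSpace 𝓘(ℝ, F) y))
  (φ : C^∞⟮𝓘(ℝ, E), M; 𝓘(ℝ, F), N⟯) {x : M} {σ : Π z : M, PullbackTangent φ z}
  {W : Π y : N, TangentSpace 𝓘(ℝ, F) y}

/-- The endomorphism `v ↦ ∇^N_v W` of the fibre of `φ⁻¹TN` at `x`. -/
def leviCivitaAlong (W : Π y : N, TangentSpace 𝓘(ℝ, F) y) (x : M) :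
    PullbackTangent φ x →L[ℝ] PullbackTangent φ x :=
  leviCivita h W (φ x)

theorem smoothAlong_leviCivitaAlong (hW : CMDiffAt ∞ (T% W) (φ x)) (hσ : SmoothAlong φ σ x) :
    SmoothAlong φ (fun z ↦ leviCivitaAlong h φ W z (σ z)) x := by
  obtain ⟨s, hs, -⟩ := exists_isOrthonormalFrameAt h (φ x)
  have hsum : SmoothAlong φ (fun z ↦ ∑ j, h.inner (φ z) (σ z) (s j (φ z)) •
      pullSection φ (fun y ↦ leviCivita h W y (s j y)) z) x :=
    ContMDiffAt.sum_section fun j _ ↦ (contMDiffAt_frameCoeff_along φ hs hσ j).smul_section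
      (smoothAlong_pullSection φ (contMDiffAt_leviCivita h (hs.contMDiffAt j) hW))
  refine smoothAlong_congr hsum ?_
  filter_upwards [eventually_eq_sum_frame_along φ hs σ] with z hz
  refine (congrArg (leviCivitaAlong h φ W z) hz).trans ?_
  simp only [map_sum, map_smul]
  rfl

variable [FiniteDimensional ℝ E]

theorem pullbackConn_push_eq_christoffelAlong (Y : Π x : M, TangentSpace 𝓘(ℝ, E) x)
    (a : TangentSpace 𝓘(ℝ, E) x) :
    pullbackConn h φ (push φ Y) x a = (trivializationAt F (PullbackTangent φ) x).symmL ℝ x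
      (mvfderiv 𝓘(ℝ, E) (fun z ↦ mvfderiv 𝓘(ℝ, E) (extChartAt 𝓘(ℝ, F) (φ x) ∘ φ) z (Y z)) x a)
        + christoffelAlong h φ x (push φ Y x) a := by
  have hcoord : (fun z ↦ (trivializationAt F (PullbackTangent φ) x ⟨z, push φ Y z⟩).2) =ᶠ[nhds x]
      fun z ↦ mvfderiv 𝓘(ℝ, E) (extChartAt 𝓘(ℝ, F) (φ x) ∘ φ) z (Y z) := by
    filter_upwards [eventually_comp φ (chart_source_mem_nhds F (φ x))] with z hz
    exact trivializationAt_push φ hz Y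
  rw [← mvfderiv_congr hcoord]
  rfl

variable [IsManifold 𝓘(ℝ, E) ∞ M]

theorem pullbackConn_pullSection (hW : MDiffAt (T% W) (φ x)) (a : TangentSpace 𝓘(ℝ, E) x) :
    pullbackConn h φ (pullSection φ W) x a = leviCivitaAlong h φ W x (differential φ x a) :=
  pullbackConn_comp h φ W x hW a

theorem isSmoothConnection_pullbackConn : IsSmoothConnection (pullbackConn h φ) := by
  intro x σ X hσ hX
  obtain ⟨s, hs, -⟩ := exists_isOrthonormalFrameAt h (φ x)
  set c := fun j z ↦ h.inner (φ z) (σ z) (s j (φ z))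
  have hc (j) : CMDiffAt ∞ (c j) x := contMDiffAt_frameCoeff_along φ hs hσ j
  have hsum : SmoothAlong φ (fun z ↦ ∑ j, (mvfderiv 𝓘(ℝ, E) (c j) z (X z) •
      pullSection φ (s j) z +
        c j z • leviCivitaAlong h φ (s j) z (push φ X z))) x :=
    ContMDiffAt.sum_section fun j _ ↦
      ((contMDiffAt_mvfderiv_apply (hc j) hX).smul_section
        (smoothAlong_pullSection φ (hs.contMDiffAt j))).add_section
      ((hc j).smul_section
        (smoothAlong_leviCivitaAlong h φ (hs.contMDiffAt j) (smoothAlong_push φ hX)))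
  refine smoothAlong_congr hsum ?_
  have hc' : ∀ᶠ z in nhds x, ∀ j, MDiffAt (c j) z :=
    Filter.eventually_all.2 fun j ↦ eventually_mdifferentiableAt (hc j)
  have hs' : ∀ᶠ z in nhds x, ∀ j, MDiffAt (T% (s j)) (φ z) := Filter.eventually_all.2 fun j ↦
    eventually_comp φ (eventually_mdifferentiableAt_section (hs.contMDiffAt j))
  have hsφ : ∀ᶠ z in nhds x, ∀ j, MDifferentiableAt 𝓘(ℝ, E) (𝓘(ℝ, E).prod 𝓘(ℝ, F))
      (fun z ↦ TotalSpace.mk' F (E := PullbackTangent φ) z (pullSection φ (s j) z)) z :=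
    Filter.eventually_all.2 fun j ↦ eventually_mdifferentiableAt_section (V := PullbackTangent φ)
      (smoothAlong_pullSection φ (hs.contMDiffAt j))
  filter_upwards [(eventually_eq_sum_frame_along φ hs σ).eventually_nhds, hc', hs', hsφ]
    with z hz hcz hsz hsφz
  have hterm j := (hcz j).smul_section (hsφz j)
  rw [conn_congr (pullbackConn h φ) (.sum_section fun j _ ↦ hterm j) hz,
    conn_sum (pullbackConn h φ) Finset.univ hterm]
  refine Finset.sum_congr rfl fun j _ ↦ ?_
  refine (conn_smul (pullbackConn h φ) (hcz j) (hsφz j) (X z)).trans ?_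
  rw [pullbackConn_pullSection h φ (hsz j)]
  rfl

theorem pullbackConn_leviCivitaAlong (hW : CMDiffAt ∞ (T% W) (φ x)) (hσ : SmoothAlong φ σ x)
    (a : TangentSpace 𝓘(ℝ, E) x) :
    pullbackConn h φ (fun z ↦ leviCivitaAlong h φ W z (σ z)) x a
        - leviCivitaAlong h φ W x (pullbackConn h φ σ x a) =
      secondCovariantDeriv h (leviCivita h) W (φ x) (differential φ x a) (σ x) := by
  let Φ (σ : Π z : M, PullbackTangent φ z) : PullbackTangent φ x :=
    pullbackConn h φ (fun z ↦ leviCivitaAlong h φ W z (σ z)) x a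
      - leviCivitaAlong h φ W x (pullbackConn h φ σ x a)
  have hsmooth {σ} (hσ : SmoothAlong φ σ x) :=
    (smoothAlong_leviCivitaAlong h φ hW hσ).mdifferentiableAt (by simp)
  have hΦ : SmoothTensorialAt E F Φ x :=
    { smul := fun {f σ} hf hσ ↦ by
        have hf' : MDiffAt f x := hf.mdifferentiableAt (by simp)
        have hfield : (fun z ↦ leviCivitaAlong h φ W z ((f • σ) z)) =
            f • fun z ↦ leviCivitaAlong h φ W z (σ z) := by
          funext z
          exact map_smul _ _ _
        simp only [Φ]
        rw [hfield, conn_smul _ hf' (hsmooth hσ),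
          conn_smul _ hf' (hσ.mdifferentiableAt (by simp)), map_add, map_smul, map_smul]
        module
      add := fun {σ τ} hσ hτ ↦ by
        have hfield : (fun z ↦ leviCivitaAlong h φ W z ((σ + τ) z)) =
            (fun z ↦ leviCivitaAlong h φ W z (σ z)) + fun z ↦ leviCivitaAlong h φ W z (τ z) := by
          funext z
          exact map_add _ _ _
        simp only [Φ]
        rw [hfield, conn_add _ (hsmooth hσ) (hsmooth hτ), conn_add _
          (hσ.mdifferentiableAt (by simp)) (hτ.mdifferentiableAt (by simp)), map_add]
        module }
  let S : Π y : N, TangentSpace 𝓘(ℝ, F) y := extend F (x := φ x) (σ x)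
  have hSx : σ x = pullSection φ S x := (extend_apply_self (x := φ x) F (σ x)).symm
  have hS : CMDiffAt ∞ (T% S) (φ x) := contMDiffAt_extend 𝓘(ℝ, F) F _
  have hpoint := hΦ.pointwise hσ (smoothAlong_pullSection φ hS) hSx
  have hWS := (contMDiffAt_leviCivita h hS hW).mdifferentiableAt (by simp)
  refine hpoint.trans (congrArg₂ (· - ·) (pullbackConn_pullSection h φ hWS a) ?_)
  exact congrArg _ (pullbackConn_pullSection h φ (hS.mdifferentiableAt (by simp)) a)

end PullbackConnection

section SecondFundamentalForm

variable {E : Type*} [NormedAddCommGroup E] [NormedSpace ℝ E] [FiniteDimensional ℝ E]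
  {M : Type*} [TopologicalSpace M] [ChartedSpace E M] [IsManifold 𝓘(ℝ, E) ∞ M]
  (g : ContMDiffRiemannianMetric 𝓘(ℝ, E) ∞ E (fun x : M ↦ TangentSpace 𝓘(ℝ, E) x)) {x : M}

theorem christoffel_symm (a b : TangentSpace 𝓘(ℝ, E) x) :
    christoffel g x a b = christoffel g x b a := by
  simp only [christoffel_apply]
  refine Finset.sum_congr rfl fun i _ ↦ ?_
  rw [metricDeriv_symm g x (onb g x i), add_comm (metricDeriv g x b a _)]

variable {F : Type*} [NormedAddCommGroup F] [NormedSpace ℝ F] [FiniteDimensional ℝ F]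
  {N : Type*} [TopologicalSpace N] [ChartedSpace F N] [IsManifold 𝓘(ℝ, F) ∞ N]
  (h : ContMDiffRiemannianMetric 𝓘(ℝ, F) ∞ F (fun y : N ↦ TangentSpace 𝓘(ℝ, F) y))
  (φ : C^∞⟮𝓘(ℝ, E), M; 𝓘(ℝ, F), N⟯) {Y Z : Π x : M, TangentSpace 𝓘(ℝ, E) x}

theorem secondFundamentalForm_symm (a b : TangentSpace 𝓘(ℝ, E) x) :
    secondFundamentalForm g h φ x a b = secondFundamentalForm g h φ x b a := by
  have hcoord : CMDiffAt ∞ (extChartAt 𝓘(ℝ, F) (φ x) ∘ φ) x :=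
    ContMDiffAt.comp x (contMDiffAt_extChartAt (I := 𝓘(ℝ, F))) φ.contMDiff.contMDiffAt
  have hΓ : christoffelAlong h φ x (push φ (extend E b) x) a =
      christoffelAlong h φ x (push φ (extend E a) x) b := by
    simp only [push, extend_apply_self]
    exact christoffel_symm h _ _
  simp only [secondFundamentalForm]
  rw [pullbackConn_push_eq_christoffelAlong, pullbackConn_push_eq_christoffelAlong,
    mvfderiv_mvfderiv_extend_comm hcoord b a, hΓ, leviCivita_extend_comm g a b]

theorem secondFundamentalForm_eq (hY : MDiffAt (T% Y) x) (a : TangentSpace 𝓘(ℝ, E) x) :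
    secondFundamentalForm g h φ x a (Y x) =
      pullbackConn h φ (push φ Y) x a - differential φ x (leviCivita g Y x a) := by
  let Φ (Y : Π x : M, TangentSpace 𝓘(ℝ, E) x) : PullbackTangent φ x :=
    pullbackConn h φ (push φ Y) x a - differential φ x (leviCivita g Y x a)
  have hΦ : TensorialAt 𝓘(ℝ, E) E Φ x :=
    { smul := fun {f Y} hf hY ↦ by
        have hfield : push φ (f • Y) = f • push φ Y := by
          funext z
          exact map_smul _ _ _
        simp only [Φ]
        rw [hfield, conn_smul _ hf (mdifferentiableAt_push φ hY), conn_smul _ hf hY, map_add,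
          map_smul, map_smul]
        simp only [push]
        module
      add := fun {Y Z} hY hZ ↦ by
        have hfield : push φ (Y + Z) = push φ Y + push φ Z := by
          funext z
          exact map_add _ _ _
        simp only [Φ]
        rw [hfield, conn_add _ (mdifferentiableAt_push φ hY) (mdifferentiableAt_push φ hZ),
          conn_add _ hY hZ, map_add]
        module }
  exact hΦ.pointwise (mdifferentiableAt_extend 𝓘(ℝ, E) E (Y x)) hY (extend_apply_self ..)

theorem pullbackConn_push (hY : MDiffAt (T% Y) x) (a : TangentSpace 𝓘(ℝ, E) x) :
    pullbackConn h φ (push φ Y) x a =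
      differential φ x (leviCivita g Y x a) + secondFundamentalForm g h φ x a (Y x) := by
  rw [secondFundamentalForm_eq g h φ hY a, add_sub_cancel]

/-- The second fundamental form at `x` as a bilinear map. -/
def secondFundamentalFormₗ (x : M) :
    TangentSpace 𝓘(ℝ, E) x →ₗ[ℝ] TangentSpace 𝓘(ℝ, E) x →ₗ[ℝ] PullbackTangent φ x :=
  have add_left (a a' b : TangentSpace 𝓘(ℝ, E) x) : secondFundamentalForm g h φ x (a + a') b =
      secondFundamentalForm g h φ x a b + secondFundamentalForm g h φ x a' b := by
    simp only [secondFundamentalForm, map_add]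
    module
  have smul_left (c : ℝ) (a b : TangentSpace 𝓘(ℝ, E) x) : secondFundamentalForm g h φ x (c • a) b =
      c • secondFundamentalForm g h φ x a b := by
    simp only [secondFundamentalForm, map_smul, smul_sub]
  LinearMap.mk₂ ℝ (secondFundamentalForm g h φ x) add_left smul_left
    (fun a b b' ↦ by simp only [secondFundamentalForm_symm g h φ a, add_left])
    (fun c a b ↦ by simp only [secondFundamentalForm_symm g h φ a, smul_left])

theorem smoothAlong_secondFundamentalForm (hY : CMDiffAt ∞ (T% Y) x) (hZ : CMDiffAt ∞ (T% Z) x) :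
    SmoothAlong φ (fun z ↦ secondFundamentalForm g h φ z (Y z) (Z z)) x := by
  have hsub : SmoothAlong φ ((fun z ↦ pullbackConn h φ (push φ Z) z (Y z)) -
      push φ (fun z ↦ leviCivita g Z z (Y z))) x :=
    (isSmoothConnection_pullbackConn h φ (smoothAlong_push φ hZ) hY).sub_section
      (smoothAlong_push φ (contMDiffAt_leviCivita g hY hZ))
  refine smoothAlong_congr hsub ?_
  filter_upwards [eventually_mdifferentiableAt_section hZ] with z hz
  exact secondFundamentalForm_eq g h φ hz (Y z)

end SecondFundamentalForm

section RicciIdentity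

variable {E : Type*} [NormedAddCommGroup E] [NormedSpace ℝ E] [FiniteDimensional ℝ E]
  {M : Type*} [TopologicalSpace M] [ChartedSpace E M] [IsManifold 𝓘(ℝ, E) ∞ M]
  (g : ContMDiffRiemannianMetric 𝓘(ℝ, E) ∞ E (fun x : M ↦ TangentSpace 𝓘(ℝ, E) x))
  {F : Type*} [NormedAddCommGroup F] [NormedSpace ℝ F] [FiniteDimensional ℝ F]
  {N : Type*} [TopologicalSpace N] [ChartedSpace F N] [IsManifold 𝓘(ℝ, F) ∞ N]
  (h : ContMDiffRiemannianMetric 𝓘(ℝ, F) ∞ F (fun y : N ↦ TangentSpace 𝓘(ℝ, F) y))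
  (φ : C^∞⟮𝓘(ℝ, E), M; 𝓘(ℝ, F), N⟯) {x : M}

/-- The curvature tensor `R^N` at `φ x`, acting on the fibre of `φ⁻¹TN` at `x`. -/
def curvatureAlong (x : M) (u v w : PullbackTangent φ x) : PullbackTangent φ x :=
  curvature h (φ x) u v w

theorem secondCovariantDeriv_pullSection {W : Π y : N, TangentSpace 𝓘(ℝ, F) y}
    (hW : CMDiffAt ∞ (T% W) (φ x)) (a b : TangentSpace 𝓘(ℝ, E) x) :
    secondCovariantDeriv g (pullbackConn h φ) (pullSection φ W) x a b
        - leviCivitaAlong h φ W x (secondFundamentalForm g h φ x a b) =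
      secondCovariantDeriv h (leviCivita h) W (φ x) (differential φ x a) (differential φ x b) := by
  have hB : CMDiffAt ∞ (T% (extend E b)) x := contMDiffAt_extend 𝓘(ℝ, E) E b
  have hnear : ∀ᶠ z in nhds x, pullbackConn h φ (pullSection φ W) z (extend E b z) =
      leviCivitaAlong h φ W z (push φ (extend E b) z) := by
    filter_upwards [eventually_comp φ (eventually_mdifferentiableAt_section hW)] with z hz
    exact pullbackConn_pullSection h φ hz _
  have hsmooth := smoothAlong_leviCivitaAlong h φ hW (smoothAlong_push φ hB)
  have hchain := pullbackConn_leviCivitaAlong h φ hW (smoothAlong_push φ hB) a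
  rw [pullbackConn_push g h φ (hB.mdifferentiableAt (by simp)), map_add, ← sub_sub] at hchain
  simp only [push, extend_apply_self] at hchain
  rw [secondCovariantDeriv, conn_congr _ (hsmooth.mdifferentiableAt (by simp)) hnear,
    pullbackConn_pullSection h φ (hW.mdifferentiableAt (by simp))]
  exact hchain

theorem secondCovariantDeriv_pullbackConn_sub {σ : Π z : M, PullbackTangent φ z}
    (hσ : SmoothAlong φ σ x) (a b : TangentSpace 𝓘(ℝ, E) x) :
    secondCovariantDeriv g (pullbackConn h φ) σ x a b
        - secondCovariantDeriv g (pullbackConn h φ) σ x b a =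
      curvatureAlong h φ x (differential φ x a) (differential φ x b) (σ x) := by
  let S : Π y : N, TangentSpace 𝓘(ℝ, F) y := extend F (x := φ x) (σ x)
  have hS : CMDiffAt ∞ (T% S) (φ x) := contMDiffAt_extend 𝓘(ℝ, F) F _
  have hSx : S (φ x) = σ x := extend_apply_self (x := φ x) F (σ x)
  have hpoint := (smoothTensorialAt_secondCovariantDeriv_sub g
    (isSmoothConnection_pullbackConn h φ) a b).pointwise hσ (smoothAlong_pullSection φ hS) hSx.symm
  have hcurv := curvature_eq_secondCovariantDeriv_sub h hS (differential φ x a) (differential φ x b)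
  rw [← secondCovariantDeriv_pullSection g h φ hS a b,
    ← secondCovariantDeriv_pullSection g h φ hS b a, secondFundamentalForm_symm g h φ b a,
    hSx] at hcurv
  refine hpoint.trans (Eq.trans ?_ hcurv.symm)
  exact (sub_sub_sub_cancel_right ..).symm

end RicciIdentity

section Codazzi

variable {E : Type*} [NormedAddCommGroup E] [NormedSpace ℝ E] [FiniteDimensional ℝ E]
  {M : Type*} [TopologicalSpace M] [ChartedSpace E M] [IsManifold 𝓘(ℝ, E) ∞ M]
  (g : ContMDiffRiemannianMetric 𝓘(ℝ, E) ∞ E (fun x : M ↦ TangentSpace 𝓘(ℝ, E) x))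
  {F : Type*} [NormedAddCommGroup F] [NormedSpace ℝ F] [FiniteDimensional ℝ F]
  {N : Type*} [TopologicalSpace N] [ChartedSpace F N] [IsManifold 𝓘(ℝ, F) ∞ N]
  (h : ContMDiffRiemannianMetric 𝓘(ℝ, F) ∞ F (fun y : N ↦ TangentSpace 𝓘(ℝ, F) y))
  (φ : C^∞⟮𝓘(ℝ, E), M; 𝓘(ℝ, F), N⟯) {x : M} {X Y Z V : Π x : M, TangentSpace 𝓘(ℝ, E) x}

/-- The covariant derivative `(∇_a ∇dφ)(Y, Z)` at `x` of the second fundamental form. The fields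
`Y` and `Z` are arguments because it is the product rule, not tensoriality, that is needed. -/
def secondFundamentalFormDeriv (Y Z : Π x : M, TangentSpace 𝓘(ℝ, E) x) (x : M)
    (a : TangentSpace 𝓘(ℝ, E) x) : PullbackTangent φ x :=
  pullbackConn h φ (fun z ↦ secondFundamentalForm g h φ z (Y z) (Z z)) x a
    - secondFundamentalForm g h φ x (leviCivita g Y x a) (Z x)
    - secondFundamentalForm g h φ x (Y x) (leviCivita g Z x a)

theorem secondFundamentalFormDeriv_symm (Y Z : Π x : M, TangentSpace 𝓘(ℝ, E) x)
    (a : TangentSpace 𝓘(ℝ, E) x) :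
    secondFundamentalFormDeriv g h φ Y Z x a = secondFundamentalFormDeriv g h φ Z Y x a := by
  simp only [secondFundamentalFormDeriv]
  rw [funext fun z ↦ secondFundamentalForm_symm g h φ (Y z) (Z z),
    secondFundamentalForm_symm g h φ _ (Z x), secondFundamentalForm_symm g h φ (Y x)]
  exact sub_right_comm ..

theorem pullbackConn_pullbackConn_push (hY : CMDiffAt ∞ (T% Y) x) (hZ : CMDiffAt ∞ (T% Z) x)
    (a : TangentSpace 𝓘(ℝ, E) x) :
    pullbackConn h φ (fun z ↦ pullbackConn h φ (push φ Z) z (Y z)) x a =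
      differential φ x (leviCivita g (fun z ↦ leviCivita g Z z (Y z)) x a)
        + secondFundamentalForm g h φ x a (leviCivita g Z x (Y x))
        + pullbackConn h φ (fun z ↦ secondFundamentalForm g h φ z (Y z) (Z z)) x a := by
  have hYZ : CMDiffAt ∞ (T% (fun z ↦ leviCivita g Z z (Y z))) x := contMDiffAt_leviCivita g hY hZ
  have hpush := (smoothAlong_push φ hYZ).mdifferentiableAt (by simp)
  have hform := (smoothAlong_secondFundamentalForm g h φ hY hZ).mdifferentiableAt (by simp)
  have hsplit : ∀ᶠ z in nhds x, pullbackConn h φ (push φ Z) z (Y z) =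
      (push φ (fun z ↦ leviCivita g Z z (Y z)) +
        fun z ↦ secondFundamentalForm g h φ z (Y z) (Z z)) z := by
    filter_upwards [eventually_mdifferentiableAt_section hZ] with z hz
    exact pullbackConn_push g h φ hz (Y z)
  rw [conn_congr _ (mdifferentiableAt_add_section hpush hform) hsplit, conn_add _ hpush hform,
    pullbackConn_push g h φ (hYZ.mdifferentiableAt (by simp))]

theorem secondCovariantDeriv_push (hY : CMDiffAt ∞ (T% Y) x) (hZ : CMDiffAt ∞ (T% Z) x)
    (a : TangentSpace 𝓘(ℝ, E) x) :
    secondCovariantDeriv g (pullbackConn h φ) (push φ Z) x a (Y x) =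
      differential φ x (secondCovariantDeriv g (leviCivita g) Z x a (Y x))
        + secondFundamentalFormDeriv g h φ Y Z x a
        + secondFundamentalForm g h φ x a (leviCivita g Z x (Y x))
        + secondFundamentalForm g h φ x (Y x) (leviCivita g Z x a) := by
  rw [secondCovariantDeriv_eq g (isSmoothConnection_pullbackConn h φ) (smoothAlong_push φ hZ) hY,
    secondCovariantDeriv_eq g (isSmoothConnection_leviCivita g) hZ hY,
    pullbackConn_pullbackConn_push g h φ hY hZ,
    pullbackConn_push g h φ (hZ.mdifferentiableAt (by simp)), map_sub, secondFundamentalFormDeriv]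
  module

theorem codazzi_equation (hX : CMDiffAt ∞ (T% X) x) (hY : CMDiffAt ∞ (T% Y) x)
    (hZ : CMDiffAt ∞ (T% Z) x) :
    curvatureAlong h φ x (push φ X x) (push φ Y x) (push φ Z x) =
      differential φ x (curvature g x (X x) (Y x) (Z x))
        + secondFundamentalFormDeriv g h φ Y Z x (X x)
        - secondFundamentalFormDeriv g h φ X Z x (Y x) := by
  have hN := secondCovariantDeriv_pullbackConn_sub g h φ (smoothAlong_push φ hZ) (X x) (Y x)
  rw [secondCovariantDeriv_push g h φ hY hZ, secondCovariantDeriv_push g h φ hX hZ] at hN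
  rw [curvature_eq_secondCovariantDeriv_sub g hZ, map_sub]
  refine hN.symm.trans ?_
  module

theorem secondCovariantDeriv_push_add_curvatureAlong (hV : CMDiffAt ∞ (T% V) x)
    (hY : CMDiffAt ∞ (T% Y) x) :
    secondCovariantDeriv g (pullbackConn h φ) (push φ V) x (Y x) (Y x)
        + curvatureAlong h φ x (push φ V x) (push φ Y x) (push φ Y x) =
      differential φ x (secondCovariantDeriv g (leviCivita g) V x (Y x) (Y x))
        + differential φ x (curvature g x (V x) (Y x) (Y x))
        + secondFundamentalFormDeriv g h φ Y Y x (V x)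
        + (2 : ℝ) • secondFundamentalForm g h φ x (Y x) (leviCivita g V x (Y x)) := by
  rw [secondCovariantDeriv_push g h φ hY hV, codazzi_equation g h φ hV hY hY,
    secondFundamentalFormDeriv_symm g h φ Y V]
  module

end Codazzi

section Tension

variable {E : Type*} [NormedAddCommGroup E] [NormedSpace ℝ E] [FiniteDimensional ℝ E]
  {M : Type*} [TopologicalSpace M] [ChartedSpace E M] [IsManifold 𝓘(ℝ, E) ∞ M]
  {g : ContMDiffRiemannianMetric 𝓘(ℝ, E) ∞ E (fun x : M ↦ TangentSpace 𝓘(ℝ, E) x)} {x : M}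
  {s : Fin (Module.finrank ℝ E) → Π x : M, TangentSpace 𝓘(ℝ, E) x}

theorem IsOrthonormalFrameAt.inner_leviCivita_skew (hs : IsOrthonormalFrameAt g x s)
    (v : TangentSpace 𝓘(ℝ, E) x) (i j : Fin (Module.finrank ℝ E)) :
    g.inner x (leviCivita g (s i) x v) (s j x) = -g.inner x (leviCivita g (s j) x v) (s i x) := by
  have hdiff (i) := (hs.contMDiffAt i).mdifferentiableAt (by simp)
  have hconst : (fun y ↦ g.inner y (s i y) (s j y)) =ᶠ[nhds x] fun _ ↦ if i = j then 1 else 0 := by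
    filter_upwards [hs.isOrthonormal] with y hy using hy i j
  have hmetric := leviCivita_metric g (hdiff i) (hdiff j) v
  rw [mvfderiv_congr hconst, mvfderiv_const, g.symm x (s i x)] at hmetric
  exact eq_neg_of_add_eq_zero_left hmetric.symm

variable {F : Type*} [NormedAddCommGroup F] [NormedSpace ℝ F] [FiniteDimensional ℝ F]
  {N : Type*} [TopologicalSpace N] [ChartedSpace F N] [IsManifold 𝓘(ℝ, F) ∞ N]
  (h : ContMDiffRiemannianMetric 𝓘(ℝ, F) ∞ F (fun y : N ↦ TangentSpace 𝓘(ℝ, F) y))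
  (φ : C^∞⟮𝓘(ℝ, E), M; 𝓘(ℝ, F), N⟯)

theorem eventually_tension_eq_sum (hs : IsOrthonormalFrameAt g x s) : ∀ᶠ z in nhds x,
    tension g h φ z = ∑ i, secondFundamentalForm g h φ z (s i z) (s i z) := by
  filter_upwards [hs.isOrthonormal] with z hz
  exact sum_apply_self_eq_of_isOrthonormal (secondFundamentalFormₗ g h φ z) (onb_orthonormal g z) hz

theorem pullbackConn_tension (hs : IsOrthonormalFrameAt g x s) (v : TangentSpace 𝓘(ℝ, E) x) :
    pullbackConn h φ (tension g h φ) x v =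
      ∑ i, secondFundamentalFormDeriv g h φ (s i) (s i) x v := by
  have hdiff i := (smoothAlong_secondFundamentalForm g h φ (hs.contMDiffAt i)
    (hs.contMDiffAt i)).mdifferentiableAt (by simp)
  have hskew : ∑ i, (secondFundamentalForm g h φ x (leviCivita g (s i) x v) (s i x)
      + secondFundamentalForm g h φ x (s i x) (leviCivita g (s i) x v)) = 0 :=
    sum_apply_add_apply_eq_zero_of_skew (secondFundamentalFormₗ g h φ x) hs.isOrthonormal_self
      (hs.inner_leviCivita_skew v)
  rw [conn_congr _ (.sum_section fun i _ ↦ hdiff i) (eventually_tension_eq_sum h φ hs),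
    conn_sum _ Finset.univ hdiff]
  simp only [secondFundamentalFormDeriv, sub_sub, Finset.sum_sub_distrib, hskew, sub_zero]

end Tension

end RiemMap

end

theorem proposition1
    {E : Type*} [NormedAddCommGroup E] [NormedSpace ℝ E] [FiniteDimensional ℝ E]
    {M : Type*} [TopologicalSpace M] [ChartedSpace E M] [IsManifold 𝓘(ℝ, E) ∞ M]
    (g : ContMDiffRiemannianMetric 𝓘(ℝ, E) ∞ E (fun x : M ↦ TangentSpace 𝓘(ℝ, E) x))
    {F : Type*} [NormedAddCommGroup F] [NormedSpace ℝ F] [FiniteDimensional ℝ F]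
    {N : Type*} [TopologicalSpace N] [ChartedSpace F N] [IsManifold 𝓘(ℝ, F) ∞ N]
    (h : ContMDiffRiemannianMetric 𝓘(ℝ, F) ∞ F (fun y : N ↦ TangentSpace 𝓘(ℝ, F) y))
    (φ : C^∞⟮𝓘(ℝ, E), M; 𝓘(ℝ, F), N⟯)
    (V : Π x : M, TangentSpace 𝓘(ℝ, E) x)
    (hV : ContMDiff 𝓘(ℝ, E) 𝓘(ℝ, E).tangent ∞
      (fun x ↦ (⟨x, V x⟩ : TangentBundle 𝓘(ℝ, E) M)))
    (x : M) :
    RiemMap.roughLaplacian g (RiemMap.pullbackConn h φ) (RiemMap.push φ V) x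
        + RiemMap.ricciAlong g h φ x (RiemMap.differential φ x (V x)) =
      RiemMap.differential φ x
          (RiemMap.roughLaplacian g (RiemMap.leviCivita g) V x + RiemMap.ricci g x (V x))
        + RiemMap.pullbackConn h φ (RiemMap.tension g h φ) x (V x)
        + (2 : ℝ) • ∑ i, RiemMap.secondFundamentalForm g h φ x (RiemMap.onb g x i)
            (RiemMap.leviCivita g V x (RiemMap.onb g x i)) := by
  obtain ⟨s, hs, hsx⟩ := RiemMap.exists_isOrthonormalFrameAt g x
  have hterm i := RiemMap.secondCovariantDeriv_push_add_curvatureAlong g h φ hV.contMDiffAt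
    (hs.contMDiffAt i)
  have hsum := Finset.sum_congr (s₁ := Finset.univ) rfl fun i _ ↦ hterm i
  simp only [Finset.sum_add_distrib, ← map_sum, ← Finset.smul_sum,
    ← RiemMap.pullbackConn_tension h φ hs, hsx, RiemMap.push] at hsum
  rw [RiemMap.roughLaplacian_eq_sum, RiemMap.roughLaplacian_eq_sum, map_add]
  exact hsum
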